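/- Let $G=SL_2(\mathbb R)$ and $\tilde G=PSL_2(\mathbb R)=G/\{\pm I\}$, with identity element $\tilde I$. Let $\tilde{\mathfrak c}_2^{++}$, $\tilde{\mathfrak c}_2^{+-}$, $\tilde{\mathfrak c}_3^{\alpha}$ ($0<\alpha<\pi$) and $\tilde{\mathfrak c}_4^{\lambda}$ ($\lambda\in\mathbb R$, $|\lambda|>1$) be the images in $\tilde G$ of the conjugacy classes in $G$ of, respectively, $$\begin{pmatrix}1&0\\1&1\end{pmatrix},\quad \begin{pmatrix}1&0\\-1&1\end{pmatrix},\quad \begin{pmatrix}\cos\alpha&-\sin\alpha\\ \sin\alpha&\cos\alpha\end{pmatrix},\quad \begin{pmatrix}\lambda&0\\0&\lambda^{-1}\end{pmatrix}.$$ Put $\tilde{\mathfrak c}_4=\bigcup_{|\lambda|>1}\tilde{\mathfrak c}_4^\lambda$ and, for an interval $j\subset(0,\pi)$, $\tilde{\mathfrak c}_3^{\,j}=\bigcup_{\gamma\in j}\tilde{\mathfrak c}_3^\gamma$. The product of subsets of $\tilde G$ is the set of products of their elements. A conjugacy class of $\tilde G$ is nontrivial if it is not $\{\tilde I\}$. **Corollary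 3.3.** (a) For $|\lambda|>1$ we have $\tilde{\mathfrak c}_4^\lambda\tilde{\mathfrak c}_4^\lambda=\tilde G$ and $$\tilde{\mathfrak c}_2^{++}\tilde{\mathfrak c}_2^{++}=\tilde{\mathfrak c}_2^{+-}\tilde{\mathfrak c}_2^{+-}=\tilde{\mathfrak c}_4^\lambda\tilde{\mathfrak c}=\tilde G\setminus\{\tilde I\}$$ for every nontrivial conjugacy class $\tilde{\mathfrak c}\ne\tilde{\mathfrak c}_4^\lambda$ of $\tilde G$. The other double products of nontrivial classes are, for $0<\alpha,\beta<\pi$: $$\tilde{\mathfrak c}_2^{++}\tilde{\mathfrak c}_2^{+-}=\{\tilde I\}\cup\tilde{\mathfrak c}_2^{++}\cup\tilde{\mathfrak c}_2^{+-}\cup\tilde{\mathfrak c}_4,$$ $$\tilde{\mathfrak c}_2^{++}\tilde{\mathfrak c}_3^{\alpha}=\tilde{\mathfrak c}_3^{(\alpha,\pi)}\cup\tilde{\mathfrak c}_2^{+-}\cup\tilde{\mathfrak c}_4,\qquad \tilde{\mathfrak c}_2^{+-}\tilde{\mathfrak c}_3^{\alpha}=\tilde{\mathfrak c}_3^{(0,\alpha)}\cup\tilde{\mathfrak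 c}_2^{++}\cup\tilde{\mathfrak c}_4,$$ $$\tilde{\mathfrak c}_3^{\alpha}\tilde{\mathfrak c}_3^{\beta}=\begin{cases}\tilde{\mathfrak c}_3^{[\alpha+\beta,\pi)}\cup\tilde{\mathfrak c}_2^{+-}\cup\tilde{\mathfrak c}_4,&\alpha+\beta<\pi,\\ \{\tilde I\}\cup\tilde{\mathfrak c}_4,&\alpha+\beta=\pi,\\ \tilde{\mathfrak c}_3^{(0,\alpha+\beta-\pi]}\cup\tilde{\mathfrak c}_2^{++}\cup\tilde{\mathfrak c}_4,&\alpha+\beta>\pi.\end{cases}$$ (b) Let $0<\alpha,\beta,\gamma<\pi$. The following triple products, with the factors taken in any order, are equal to $\tilde G\setminus\{\tilde I\}$: - $\tilde{\mathfrak c}_2^{++}\tilde{\mathfrak c}_2^{+-}\tilde{\mathfrak c}_3^\alpha$; - $\tilde{\mathfrak c}_2^{+-}\tilde{\mathfrak c}_3^\alpha\tilde{\mathfrak c}_3^\beta$ if $\alpha+\beta<\pi$; - $\tilde{\mathfrak c}_2^{++}\tilde{\mathfrak c}_3^\alpha\tilde{\mathfrak c}_3^\beta$ and $\tilde{\mathfrak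 c}_2^{+-}\tilde{\mathfrak c}_3^\alpha\tilde{\mathfrak c}_3^\beta$ if $\alpha+\beta=\pi$; - $\tilde{\mathfrak c}_2^{++}\tilde{\mathfrak c}_3^\alpha\tilde{\mathfrak c}_3^\beta$ if $\alpha+\beta>\pi$; - $\tilde{\mathfrak c}_3^\alpha\tilde{\mathfrak c}_3^\beta\tilde{\mathfrak c}_3^\gamma$ if $\pi<\alpha+\beta+\gamma<2\pi$. The product of any other three nontrivial conjugacy classes of $\tilde G$ is the whole $\tilde G$. (c) The product of any four nontrivial conjugacy classes of $\tilde G$ is the whole $\tilde G$. -/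

import Mathlib

open scoped Pointwise

noncomputable section

/-- The group `SL₂(ℝ)`. -/
abbrev SL2R : Type := Matrix.SpecialLinearGroup (Fin 2) ℝ

/-- The group `PSL₂(ℝ)`, the quotient of `SL₂(ℝ)` by its center `{I, -I}`. -/
abbrev PSL2R : Type := Matrix.ProjectiveSpecialLinearGroup (Fin 2) ℝ

/-- The lower triangular matrix with diagonal `(ε, ε)` and lower left entry `δ`, for signs `ε, δ`. -/
def parabolicRep (ε δ : ℤˣ) : SL2R :=
  ⟨!![((ε : ℤ) : ℝ), 0; ((δ : ℤ) : ℝ), ((ε : ℤ) : ℝ)], by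
    rcases Int.units_eq_one_or ε with rfl | rfl <;> simp [Matrix.det_fin_two]⟩

/-- The rotation by the angle `α`. -/
def rotationRep (α : ℝ) : SL2R :=
  ⟨!![Real.cos α, -Real.sin α; Real.sin α, Real.cos α], by
    have h := Real.cos_sq_add_sin_sq α
    rw [Matrix.det_fin_two_of]
    linarith⟩

/-- The diagonal matrix `diag(l, l⁻¹)`. -/
def diagonalRep (l : ℝˣ) : SL2R :=
  ⟨!![(l : ℝ), 0; 0, ((l⁻¹ : ℝˣ) : ℝ)], by simp [Matrix.det_fin_two]⟩

/-- The conjugacy class `𝔠₂^{ε,δ}` in `SL₂(ℝ)`. -/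
def cl2 (ε δ : ℤˣ) : Set SL2R := conjugatesOf (parabolicRep ε δ)

/-- The conjugacy class `𝔠₃^α` in `SL₂(ℝ)` (for `α` not a multiple of `π`). -/
def cl3 (α : ℝ) : Set SL2R := conjugatesOf (rotationRep α)

/-- The conjugacy class `𝔠₄^l` in `SL₂(ℝ)` (for `|l| > 1`). -/
def cl4 (l : ℝˣ) : Set SL2R := conjugatesOf (diagonalRep l)

/-- The image in `PSL₂(ℝ)` of a subset of `SL₂(ℝ)`. -/
def tildeImage (X : Set SL2R) : Set PSL2R :=
  (QuotientGroup.mk : SL2R → PSL2R) '' X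

/-- The image `𝔠̃₂^{++}`. -/
def tcl2pp : Set PSL2R := tildeImage (cl2 1 1)

/-- The image `𝔠̃₂^{+-}`. -/
def tcl2pm : Set PSL2R := tildeImage (cl2 1 (-1))

/-- The image `𝔠̃₃^α`. -/
def tcl3 (α : ℝ) : Set PSL2R := tildeImage (cl3 α)

/-- The image `𝔠̃₄^l`. -/
def tcl4 (l : ℝˣ) : Set PSL2R := tildeImage (cl4 l)

/-- The union `𝔠̃₄` of all classes `𝔠̃₄^l`, `|l| > 1`. -/
def tcl4All : Set PSL2R := ⋃ (l : ℝˣ) (_ : 1 < |(l : ℝ)|), tcl4 l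

/-- `X` is a nontrivial conjugacy class of `PSL₂(ℝ)`. -/
def IsNontrivialClass (X : Set PSL2R) : Prop :=
  ∃ g : PSL2R, g ≠ 1 ∧ X = conjugatesOf g

/-- The list of exceptional (unordered) triples of conjugacy classes of `PSL₂(ℝ)`. -/
inductive ListedTriple : Multiset (Set PSL2R) → Prop
  | pp_pm_rot (α : ℝ) (hα : α ∈ Set.Ioo 0 Real.pi) :
      ListedTriple {tcl2pp, tcl2pm, tcl3 α}
  | pm_rot_rot_lt (α β : ℝ) (hα : α ∈ Set.Ioo 0 Real.pi) (hβ : β ∈ Set.Ioo 0 Real.pi)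
      (h : α + β < Real.pi) : ListedTriple {tcl2pm, tcl3 α, tcl3 β}
  | pp_rot_rot_eq (α β : ℝ) (hα : α ∈ Set.Ioo 0 Real.pi) (hβ : β ∈ Set.Ioo 0 Real.pi)
      (h : α + β = Real.pi) : ListedTriple {tcl2pp, tcl3 α, tcl3 β}
  | pm_rot_rot_eq (α β : ℝ) (hα : α ∈ Set.Ioo 0 Real.pi) (hβ : β ∈ Set.Ioo 0 Real.pi)
      (h : α + β = Real.pi) : ListedTriple {tcl2pm, tcl3 α, tcl3 β}
  | pp_rot_rot_gt (α β : ℝ) (hα : α ∈ Set.Ioo 0 Real.pi) (hβ : β ∈ Set.Ioo 0 Real.pi)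
      (h : Real.pi < α + β) : ListedTriple {tcl2pp, tcl3 α, tcl3 β}
  | rot_rot_rot (α β γ : ℝ) (hα : α ∈ Set.Ioo 0 Real.pi) (hβ : β ∈ Set.Ioo 0 Real.pi)
      (hγ : γ ∈ Set.Ioo 0 Real.pi) (h₁ : Real.pi < α + β + γ) (h₂ : α + β + γ < 2 * Real.pi) :
      ListedTriple {tcl3 α, tcl3 β, tcl3 γ}

end

/-! For `g` with `g ≠ ±1` the quadratic form `v ↦ det (v, g v)` is not zero, so after replacing `g`
by `-g` if necessary it takes a positive value. Scaling such a `v` makes `(v, g v)` a basis of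
determinant one, in which `g` becomes the companion matrix of `X² - t X + 1`, `t = tr g`. Hence the
nontrivial classes of `PSL₂(ℝ)` are the classes `C t = companionClass t` with `t` real, where `t` is
unique except that `C t = C (-t)` if `t² > 4`. The values `2`, `-2`, `2 cos α` and `|t| > 2` give
the four families of the statement, and inversion is `t ↦ -t`.

A set closed under conjugation is thus determined by whether it contains `1` and by the set of `u`
whose companion matrix it contains. For `C s * C t` the first factor may be fixed at a convenient
`r`, and the question is which traces `r * y` attains, with which sign of the form. Against a
unipotent `r` the trace changes by the upper right entry of `y`, whose sign is known if `|t| ≤ 2`. A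
diagonal `r` imposes no restriction. A rotation by `α` rotates the pair (trace, skew); as the skew
of a positive `y` of trace `2 cos β` ranges over `[2 sin β, ∞)`, the trace of the product ranges
over `(-∞, 2 cos (α + β)]` (`companionSL_mem_elliptic_mul_of_le`, `sltr_rotationRep_mul_le`).

Every double product contains a hyperbolic class (`hyperbolic_mem_mul`), and a hyperbolic class
times any nontrivial class contains all of them (`companionSL_mem_hyperbolic_mul`). So a triple
product can miss only `1`, and `1 ∈ C s * C t * C w` exactly when `C (-w)` occurs in `C s * C t`,
which the double products decide. A fourth factor always finds its inverse. -/

/-- The projection `SL₂(ℝ) → PSL₂(ℝ)`. -/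
def toPSL : SL2R →* PSL2R := QuotientGroup.mk' _

/-- The matrix with rows `(a, b)` and `(c, d)` as an element of `SL₂(ℝ)`. -/
def sl2 (a b c d : ℝ) (h : a * d - b * c = 1) : SL2R :=
  ⟨!![a, b; c, d], by rw [Matrix.det_fin_two_of]; exact h⟩

/-- The trace of an element of `SL₂(ℝ)`. -/
def sltr (g : SL2R) : ℝ := g 0 0 + g 1 1

/-- The trace of the quadratic form `v ↦ det (v, g v)`; for non-hyperbolic `g ≠ ± 1` its sign tells
the sense of rotation of `g`. -/
def slskew (g : SL2R) : ℝ := g 1 0 - g 0 1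

/-- `g` is hyperbolic or moves the lines of the plane in the positive sense. -/
def IsPositive (g : SL2R) : Prop := 0 < slskew g ∨ 4 < sltr g ^ 2

/-- The companion matrix of `X² - t X + 1`. -/
def companionSL (t : ℝ) : SL2R := sl2 0 (-1) 1 t (by ring)

/-- The conjugacy class in `PSL₂(ℝ)` of the companion matrix of `X² - t X + 1`. -/
def companionClass (t : ℝ) : Set PSL2R := conjugatesOf (toPSL (companionSL t))

/-! ### Coordinates, trace and skew in `SL₂(ℝ)` -/

theorem sl2_det (g : SL2R) : g 0 0 * g 1 1 - g 0 1 * g 1 0 = 1 := by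
  have := g.det_coe
  rwa [Matrix.det_fin_two] at this

theorem exists_eq_sl2 (g : SL2R) : ∃ a b c d h, g = sl2 a b c d h := by
  refine ⟨g 0 0, g 0 1, g 1 0, g 1 1, sl2_det g, ?_⟩
  ext i j
  fin_cases i <;> fin_cases j <;> rfl

theorem sl2_mul (a b c d h a' b' c' d' h') : sl2 a b c d h * sl2 a' b' c' d' h' =
    sl2 (a * a' + b * c') (a * b' + b * d') (c * a' + d * c') (c * b' + d * d')
      (by linear_combination (a' * d' - b' * c') * h + h') := by
  ext i j
  rw [Matrix.SpecialLinearGroup.coe_mul, Matrix.mul_apply, Fin.sum_univ_two]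
  fin_cases i <;> fin_cases j <;> rfl

theorem sl2_congr {a b c d a' b' c' d' h h'} (ha : a = a') (hb : b = b') (hc : c = c')
    (hd : d = d') : sl2 a b c d h = sl2 a' b' c' d' h' := by
  subst ha hb hc hd; rfl

theorem sl2_inv (a b c d h) : (sl2 a b c d h)⁻¹ = sl2 d (-b) (-c) a (by linarith) := by
  rw [inv_eq_iff_mul_eq_one, sl2_mul]
  ext i j
  fin_cases i <;> fin_cases j <;> simp [sl2] <;> linarith

theorem neg_sl2 (a b c d h) : -sl2 a b c d h = sl2 (-a) (-b) (-c) (-d) (by linarith) := by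
  ext i j
  rw [Matrix.SpecialLinearGroup.coe_neg, Matrix.neg_apply]
  fin_cases i <;> fin_cases j <;> rfl

@[simp] theorem sltr_sl2 (a b c d h) : sltr (sl2 a b c d h) = a + d := rfl

@[simp] theorem slskew_sl2 (a b c d h) : slskew (sl2 a b c d h) = c - b := rfl

@[simp] theorem sltr_neg (g : SL2R) : sltr (-g) = -sltr g := by
  obtain ⟨a, b, c, d, h, rfl⟩ := exists_eq_sl2 g
  rw [neg_sl2]; simp; ring

@[simp] theorem slskew_neg (g : SL2R) : slskew (-g) = -slskew g := by
  obtain ⟨a, b, c, d, h, rfl⟩ := exists_eq_sl2 g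
  rw [neg_sl2]; simp; ring

@[simp] theorem sltr_companionSL (t : ℝ) : sltr (companionSL t) = t := by simp [companionSL]

@[simp] theorem slskew_companionSL (t : ℝ) : slskew (companionSL t) = 2 := by
  simp [companionSL]; norm_num

/-! ### Positive elements and companion matrices -/

/-- The form `c x² + (d - a) x y - b y²` has trace `c - b` and discriminant `(a + d)² - 4`. It takes
a positive value if its trace is positive or if it is indefinite. -/
theorem exists_det_pos {a b c d : ℝ} (h : a * d - b * c = 1)
    (hp : 0 < c - b ∨ 4 < (a + d) ^ 2) :
    ∃ x y : ℝ, 0 < x * (c * x + d * y) - y * (a * x + b * y) := by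
  by_cases hc : 0 < c
  · exact ⟨1, 0, by simpa⟩
  by_cases hb : b < 0
  · exact ⟨0, 1, by simpa⟩
  have h4 : 4 < (a + d) ^ 2 := hp.resolve_left (by linarith)
  push Not at hc hb
  rcases hc.lt_or_eq with hc | rfl
  -- On the line `y = 1` this is the vertex of a parabola opening downwards.
  · refine ⟨-(d - a) / (2 * c), 1, ?_⟩
    have hd : (a + d) ^ 2 - 4 = (d - a) ^ 2 + 4 * b * c := by linear_combination 4 * h
    have : -(d - a) / (2 * c) * (c * (-(d - a) / (2 * c)) + d * 1)
        - 1 * (a * (-(d - a) / (2 * c)) + b * 1) = ((a + d) ^ 2 - 4) / (4 * (-c)) := by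
      have := hc.ne
      rw [hd]
      field_simp
      ring
    rw [this]
    exact div_pos (by linarith) (by linarith)
  · have had : d - a ≠ 0 := by
      intro h0
      have : d = a := by linarith
      subst this
      nlinarith
    -- With `c = 0` the form is affine in `x` on the line `y = 1`; here it has value `1`.
    refine ⟨(b + 1) / (d - a), 1, ?_⟩
    have : (b + 1) / (d - a) * (0 * ((b + 1) / (d - a)) + d * 1)
        - 1 * (a * ((b + 1) / (d - a)) + b * 1) = 1 := by
      field_simp
      ring
    rw [this]
    exact one_pos

/-- In the basis `(v, g v)` the matrix of `g` is the companion matrix, by Cayley–Hamilton. The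
factor `k` normalizes the determinant `q` of this basis to one. -/
theorem IsPositive.isConj_companionSL {g : SL2R} (hg : IsPositive g) :
    IsConj g (companionSL (sltr g)) := by
  obtain ⟨a, b, c, d, h, rfl⟩ := exists_eq_sl2 g
  obtain ⟨x, y, hq⟩ := exists_det_pos h hg
  set q := x * (c * x + d * y) - y * (a * x + b * y) with hqd
  set k := (√q)⁻¹ with hk
  have hk2 : k ^ 2 * q = 1 := by
    rw [hk, inv_pow, Real.sq_sqrt hq.le, inv_mul_cancel₀ hq.ne']
  refine (isConj_iff.2 ⟨sl2 (k * x) (k * (a * x + b * y)) (k * y) (k * (c * x + d * y)) ?_, ?_⟩).symm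
  · linear_combination hk2
  · rw [mul_inv_eq_iff_eq_mul, companionSL, sl2_mul, sl2_mul]
    apply sl2_congr
    · ring
    · simp; linear_combination (k * x) * h
    · ring
    · simp; linear_combination (k * y) * h

theorem sltr_conj (g h : SL2R) : sltr (h * g * h⁻¹) = sltr g := by
  obtain ⟨a, b, c, d, e, rfl⟩ := exists_eq_sl2 g
  obtain ⟨a', b', c', d', e', rfl⟩ := exists_eq_sl2 h
  rw [sl2_inv, sl2_mul, sl2_mul]
  simp
  linear_combination (a + d) * e'

/-- The skew of the conjugate is the sum of the values of `u² + v² - t u v` at the two rows of `h`.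
For `t² ≤ 4` this form is semidefinite, and if both values vanished the rows would be dependent. -/
theorem isPositive_conj_companionSL (t : ℝ) (h : SL2R) :
    IsPositive (h * companionSL t * h⁻¹) := by
  rw [IsPositive, sltr_conj, sltr_companionSL]
  by_cases ht : 4 < t ^ 2
  · exact Or.inr ht
  left
  obtain ⟨p, q, r, s, e, rfl⟩ := exists_eq_sl2 h
  rw [companionSL, sl2_inv, sl2_mul, sl2_mul]
  simp only [slskew_sl2]
  have h1 : ∀ u v : ℝ, 0 ≤ u ^ 2 + v ^ 2 - u * v * t := fun u v => by
    nlinarith [sq_nonneg (u - v * t / 2), sq_nonneg v]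
  have key : (p ^ 2 + q ^ 2 - p * q * t) + (r ^ 2 + s ^ 2 - r * s * t) ≠ 0 := by
    intro h0
    have hp : p ^ 2 + q ^ 2 - p * q * t = 0 := by linarith [h1 p q, h1 r s]
    have hr : r ^ 2 + s ^ 2 - r * s * t = 0 := by linarith [h1 p q, h1 r s]
    have e1 : (p - q * t / 2) ^ 2 + q ^ 2 * (4 - t ^ 2) / 4 = 0 := by linarith
    have e2 : (r - s * t / 2) ^ 2 + s ^ 2 * (4 - t ^ 2) / 4 = 0 := by linarith
    have p1 : p - q * t / 2 = 0 := by
      have : 0 ≤ q ^ 2 * (4 - t ^ 2) := mul_nonneg (sq_nonneg _) (by linarith)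
      exact pow_eq_zero_iff two_ne_zero |>.1 (by linarith [sq_nonneg (p - q * t / 2)])
    have r1 : r - s * t / 2 = 0 := by
      have : 0 ≤ s ^ 2 * (4 - t ^ 2) := mul_nonneg (sq_nonneg _) (by linarith)
      exact pow_eq_zero_iff two_ne_zero |>.1 (by linarith [sq_nonneg (r - s * t / 2)])
    have : p * s - q * r = 0 := by linear_combination s * p1 - q * r1
    linarith
  have := lt_of_le_of_ne (add_nonneg (h1 p q) (h1 r s)) key.symm
  linarith

/-! ### Companion classes in `PSL₂(ℝ)` -/

theorem toPSL_surjective : Function.Surjective toPSL := QuotientGroup.mk'_surjective _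

theorem toPSL_eq_iff {g h : SL2R} : toPSL g = toPSL h ↔ g = h ∨ g = -h := by
  have : toPSL g = toPSL h ↔ g⁻¹ * h ∈ Subgroup.center SL2R := QuotientGroup.eq
  rw [this, Matrix.SpecialLinearGroup.mem_center_iff]
  constructor
  · rintro ⟨r, hr, hrg⟩
    have hr' : r = 1 ∨ r = -1 := by simpa using hr
    rcases hr' with rfl | rfl
    · left
      have : g⁻¹ * h = 1 := by
        apply Subtype.ext; rw [← hrg]; simp
      rwa [inv_mul_eq_one] at this
    · right
      have : g⁻¹ * h = -1 := by
        apply Subtype.ext; rw [← hrg]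
        ext i j; fin_cases i <;> fin_cases j <;> simp
      rw [inv_mul_eq_iff_eq_mul] at this
      rw [this]; simp
  · rintro (rfl | rfl)
    · exact ⟨1, by simp, by simp⟩
    · refine ⟨-1, by simp, ?_⟩
      rw [show (-h)⁻¹ * h = -1 from inv_mul_eq_iff_eq_mul.2 (by simp)]
      ext i j; fin_cases i <;> fin_cases j <;> simp

@[simp] theorem toPSL_neg (g : SL2R) : toPSL (-g) = toPSL g := toPSL_eq_iff.2 (Or.inr rfl)

/-- The two alternatives correspond to the lifts `g` and `-g`. -/
theorem toPSL_mem_companionClass {g : SL2R} {t : ℝ} : toPSL g ∈ companionClass t ↔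
    (sltr g = t ∧ (0 < slskew g ∨ 4 < t ^ 2)) ∨ (sltr g = -t ∧ (slskew g < 0 ∨ 4 < t ^ 2)) := by
  change IsConj _ _ ↔ _
  constructor
  · intro h
    obtain ⟨c, hc⟩ := isConj_iff.1 h
    obtain ⟨k, rfl⟩ := toPSL_surjective c
    rw [← map_mul, ← map_inv, ← map_mul, eq_comm, toPSL_eq_iff] at hc
    have hp := isPositive_conj_companionSL t k
    have ht := sltr_conj (companionSL t) k
    rw [sltr_companionSL] at ht
    rw [IsPositive, ht] at hp
    rcases hc with rfl | rfl
    · exact Or.inl ⟨ht, hp⟩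
    · right; simpa [ht] using hp
  · have key : ∀ g : SL2R, sltr g = t ∧ (0 < slskew g ∨ 4 < t ^ 2) →
        IsConj (toPSL (companionSL t)) (toPSL g) := by
      rintro g ⟨rfl, h⟩
      exact (toPSL.map_isConj (IsPositive.isConj_companionSL h)).symm
    rintro (h | ⟨h, h'⟩)
    · exact key g h
    · rw [← toPSL_neg g]
      exact key (-g) (by simpa [h])

theorem toPSL_companionSL_mem {u t : ℝ} : toPSL (companionSL u) ∈ companionClass t ↔
    u = t ∨ (u = -t ∧ 4 < t ^ 2) := by
  rw [toPSL_mem_companionClass]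
  simp [not_lt.2 (zero_le_two (α := ℝ))]

/-! ### Sets closed under conjugation -/

/-- A set that contains with an element all its conjugates. -/
def IsConjClosed {G : Type*} [Group G] (X : Set G) : Prop :=
  ∀ x ∈ X, ∀ y, IsConj x y → y ∈ X

section ConjClosed

variable {G : Type*} [Group G] {X Y : Set G}

theorem isConjClosed_conjugatesOf (g : G) : IsConjClosed (conjugatesOf g) :=
  fun _ hx _ hy => IsConj.trans hx hy

theorem isConjClosed_one : IsConjClosed ({1} : Set G) := by
  rintro x rfl y hy
  exact isConj_one_right.1 hy

theorem IsConjClosed.union (hX : IsConjClosed X) (hY : IsConjClosed Y) :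
    IsConjClosed (X ∪ Y) :=
  fun x hx y hy => hx.imp (fun h => hX x h y hy) (fun h => hY x h y hy)

theorem isConjClosed_iUnion {ι : Sort*} {X : ι → Set G} (h : ∀ i, IsConjClosed (X i)) :
    IsConjClosed (⋃ i, X i) := by
  intro x hx y hy
  obtain ⟨i, hi⟩ := Set.mem_iUnion.1 hx
  exact Set.mem_iUnion.2 ⟨i, h i x hi y hy⟩

theorem IsConjClosed.mul (hX : IsConjClosed X) (hY : IsConjClosed Y) :
    IsConjClosed (X * Y) := by
  rintro _ ⟨x, hx, y, hy, rfl⟩ z hz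
  obtain ⟨c, rfl⟩ := isConj_iff.1 hz
  exact ⟨c * x * c⁻¹, hX x hx _ (isConj_iff.2 ⟨c, rfl⟩), c * y * c⁻¹,
    hY y hy _ (isConj_iff.2 ⟨c, rfl⟩), by simp⟩

theorem IsConjClosed.mul_comm (hX : IsConjClosed X) : X * Y = Y * X := by
  apply Set.Subset.antisymm
  · rintro _ ⟨x, hx, y, hy, rfl⟩
    exact ⟨y, hy, y⁻¹ * x * y, hX x hx _ (isConj_iff.2 ⟨y⁻¹, by simp⟩), by simp [mul_assoc]⟩
  · rintro _ ⟨y, hy, x, hx, rfl⟩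
    exact ⟨y * x * y⁻¹, hX x hx _ (isConj_iff.2 ⟨y, rfl⟩), y, hy, by simp⟩

theorem IsConjClosed.conjugatesOf_subset (hX : IsConjClosed X) {g : G} (hg : g ∈ X) :
    conjugatesOf g ⊆ X := fun _ hy => hX g hg _ hy

end ConjClosed

/-! ### Parametrization of the nontrivial classes by the trace -/

theorem isConjClosed_companionClass (t : ℝ) : IsConjClosed (companionClass t) :=
  isConjClosed_conjugatesOf _

theorem isConj_iff_mem_companionClass {t : ℝ} {z : PSL2R} :
    IsConj z (toPSL (companionSL t)) ↔ z ∈ companionClass t := isConj_comm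

theorem companionSL_mem_companionClass (t : ℝ) : toPSL (companionSL t) ∈ companionClass t :=
  mem_conjugatesOf_self

theorem IsPositive.conjugatesOf_eq {g : SL2R} (hg : IsPositive g) :
    conjugatesOf (toPSL g) = companionClass (sltr g) :=
  (toPSL.map_isConj hg.isConj_companionSL).conjugatesOf_eq

theorem companionClass_neg {t : ℝ} (ht : 4 < t ^ 2) :
    companionClass (-t) = companionClass t := by
  refine IsConj.conjugatesOf_eq (isConj_iff_mem_companionClass.2 ?_)
  exact toPSL_companionSL_mem.2 (Or.inr ⟨rfl, ht⟩)

theorem one_notMem_companionClass (t : ℝ) : (1 : PSL2R) ∉ companionClass t := by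
  rw [← map_one toPSL, toPSL_mem_companionClass]
  have h1 : sltr 1 = 2 := by simp [sltr]; norm_num
  have h2 : slskew 1 = 0 := by simp [slskew]
  rw [h1, h2]
  rintro (⟨rfl, h⟩ | ⟨h, h'⟩)
  · norm_num at h
  · obtain rfl : t = -2 := by linarith
    norm_num at h'

theorem exists_mem_companionClass {z : PSL2R} (hz : z ≠ 1) : ∃ t, z ∈ companionClass t := by
  obtain ⟨g, rfl⟩ := toPSL_surjective z
  by_cases h1 : IsPositive g
  · exact ⟨sltr g, h1.conjugatesOf_eq ▸ mem_conjugatesOf_self⟩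
  by_cases h2 : IsPositive (-g)
  · refine ⟨sltr (-g), h2.conjugatesOf_eq ▸ ?_⟩
    rw [toPSL_neg]
    exact mem_conjugatesOf_self
  exfalso
  obtain ⟨a, b, c, d, h, rfl⟩ := exists_eq_sl2 g
  simp only [IsPositive, slskew_neg, sltr_neg, not_or, not_lt, slskew_sl2, sltr_sl2] at h1 h2
  obtain rfl : c = b := by linarith
  -- The skew vanishes, so the matrix is symmetric, and the left side is `tr² - 4`. This forces a
  -- scalar matrix.
  have h3 : (a - d) ^ 2 + (2 * c) ^ 2 ≤ 0 := by linarith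
  have hc : c = 0 := by
    have : (2 * c) ^ 2 = 0 := le_antisymm (by linarith [sq_nonneg (a - d)]) (sq_nonneg _)
    simpa using this
  have had : a = d := by
    have : (a - d) ^ 2 = 0 := le_antisymm (by linarith [sq_nonneg (2 * c)]) (sq_nonneg _)
    exact sub_eq_zero.1 (pow_eq_zero_iff two_ne_zero |>.1 this)
  subst hc had
  apply hz
  rw [← map_one toPSL, toPSL_eq_iff]
  have : a = 1 ∨ a = -1 := mul_self_eq_one_iff.1 (by linarith)
  rcases this with rfl | rfl
  · left
    ext i j; fin_cases i <;> fin_cases j <;> simp [sl2]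
  · right
    ext i j; fin_cases i <;> fin_cases j <;> simp [sl2]

theorem isNontrivialClass_iff {X : Set PSL2R} :
    IsNontrivialClass X ↔ ∃ t, X = companionClass t := by
  constructor
  · rintro ⟨g, hg, rfl⟩
    obtain ⟨t, ht⟩ := exists_mem_companionClass hg
    exact ⟨t, (IsConj.conjugatesOf_eq ht).symm⟩
  · rintro ⟨t, rfl⟩
    refine ⟨_, fun h => one_notMem_companionClass t ?_, rfl⟩
    rw [← h]
    exact companionSL_mem_companionClass t

theorem IsConjClosed.ext_companionSL {X Y : Set PSL2R} (hX : IsConjClosed X)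
    (hY : IsConjClosed Y) (h1 : 1 ∈ X ↔ 1 ∈ Y)
    (h : ∀ u, toPSL (companionSL u) ∈ X ↔ toPSL (companionSL u) ∈ Y) : X = Y := by
  ext z
  by_cases hz : z = 1
  · rw [hz, h1]
  · obtain ⟨u, hu⟩ := exists_mem_companionClass hz
    exact ⟨fun hx => hY _ ((h u).1 (hX _ hx _ (IsConj.symm hu))) _ hu,
      fun hx => hX _ ((h u).2 (hY _ hx _ (IsConj.symm hu))) _ hu⟩

theorem IsConjClosed.compl_one_subset {X : Set PSL2R} (hX : IsConjClosed X)
    (h : ∀ u, toPSL (companionSL u) ∈ X) : {1}ᶜ ⊆ X := by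
  intro z hz
  obtain ⟨u, hu⟩ := exists_mem_companionClass hz
  exact hX _ (h u) _ hu

/-! ### Membership in products, inversion, and the identity -/

/-- Conjugating both factors simultaneously moves the first one to `r`; the second is then lifted
with the sign that makes it positive of trace `t`. -/
theorem companionSL_mem_mul_iff {r : SL2R} {t u : ℝ} (hr : IsPositive r) :
    toPSL (companionSL u) ∈ companionClass (sltr r) * companionClass t ↔
      ∃ y, sltr y = t ∧ IsPositive y ∧ toPSL (r * y) ∈ companionClass u := by
  rw [← hr.conjugatesOf_eq]
  constructor
  · rintro ⟨x, hx, y, hy, hxy⟩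
    obtain ⟨c, rfl⟩ := isConj_iff.1 (show IsConj (toPSL r) x from hx)
    have hy' : c⁻¹ * y * c ∈ companionClass t :=
      isConjClosed_companionClass t y hy _ (isConj_iff.2 ⟨c⁻¹, by simp⟩)
    obtain ⟨w, hw⟩ := toPSL_surjective (c⁻¹ * y * c)
    have hmem : toPSL (r * w) ∈ companionClass u := by
      rw [← isConj_iff_mem_companionClass, ← hxy, map_mul, hw]
      exact isConj_iff.2 ⟨c, by simp [mul_assoc]⟩
    rw [← hw, toPSL_mem_companionClass] at hy'
    rcases hy' with ⟨rfl, h⟩ | ⟨h, h'⟩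
    · exact ⟨w, rfl, h, hmem⟩
    · refine ⟨-w, by simp [h], ?_, ?_⟩
      · simpa [IsPositive, h] using h'
      · rwa [mul_neg, toPSL_neg]
  · rintro ⟨y, rfl, hy, hmem⟩
    refine (isConjClosed_conjugatesOf _).mul (isConjClosed_companionClass _) _ ?_ _
      (isConj_iff_mem_companionClass.2 hmem)
    rw [map_mul]
    refine Set.mul_mem_mul mem_conjugatesOf_self ?_
    rw [← hy.conjugatesOf_eq]
    exact mem_conjugatesOf_self

theorem companionSL_mem_mul {r y : SL2R} (hr : IsPositive r) (hy : IsPositive y)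
    (hry : IsPositive (r * y)) :
    toPSL (companionSL (sltr (r * y))) ∈ companionClass (sltr r) * companionClass (sltr y) := by
  rw [companionSL_mem_mul_iff hr]
  exact ⟨y, rfl, hy, hry.conjugatesOf_eq ▸ mem_conjugatesOf_self⟩

theorem companionSL_neg_mem_iff {X : Set PSL2R} (hX : IsConjClosed X) {u : ℝ} (hu : 4 < u ^ 2) :
    toPSL (companionSL (-u)) ∈ X ↔ toPSL (companionSL u) ∈ X := by
  have : IsConj (toPSL (companionSL (-u))) (toPSL (companionSL u)) :=
    isConj_iff_mem_companionClass.2 (toPSL_companionSL_mem.2 (Or.inr ⟨rfl, hu⟩))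
  exact ⟨fun h => hX _ h _ this, fun h => hX _ h _ this.symm⟩

/-- Inversion in `SL₂(ℝ)` keeps the trace and reverses the skew, so for a positive non-hyperbolic
`g` the positive lift of the inverse is `-g⁻¹`, of trace `-t`. -/
theorem inv_companionClass (t : ℝ) : (companionClass t)⁻¹ = companionClass (-t) := by
  ext z
  obtain ⟨g, rfl⟩ := toPSL_surjective z
  rw [Set.mem_inv, ← map_inv, toPSL_mem_companionClass, toPSL_mem_companionClass]
  obtain ⟨a, b, c, d, h, rfl⟩ := exists_eq_sl2 g
  simp only [sl2_inv, sltr_sl2, slskew_sl2, neg_sq, neg_neg, add_comm d a]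
  have e1 : 0 < -c - -b ↔ c - b < 0 := by constructor <;> intro <;> linarith
  have e2 : -c - -b < 0 ↔ 0 < c - b := by constructor <;> intro <;> linarith
  rw [e1, e2]
  exact or_comm

theorem companionClass_mul_comm (s t : ℝ) :
    companionClass s * companionClass t = companionClass t * companionClass s :=
  (isConjClosed_companionClass s).mul_comm

theorem isConjClosed_companionClass_mul (s t : ℝ) :
    IsConjClosed (companionClass s * companionClass t) :=
  (isConjClosed_companionClass s).mul (isConjClosed_companionClass t)

theorem inv_companionSL_mem {X : Set PSL2R} (hX : IsConjClosed X) (u : ℝ) :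
    (toPSL (companionSL u))⁻¹ ∈ X ↔ toPSL (companionSL (-u)) ∈ X := by
  have : IsConj (toPSL (companionSL u))⁻¹ (toPSL (companionSL (-u))) := by
    rw [isConj_iff_mem_companionClass, ← inv_companionClass]
    simpa using companionSL_mem_companionClass u
  exact ⟨fun h => hX _ h _ this, fun h => hX _ h _ this.symm⟩

/-- This symmetry exchanges `2` with `-2` and `α` with `π - α`, and so halves the case analysis. -/
theorem companionSL_neg_mem_mul_neg {s t u : ℝ} :
    toPSL (companionSL (-u)) ∈ companionClass (-s) * companionClass (-t) ↔
      toPSL (companionSL u) ∈ companionClass s * companionClass t := by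
  rw [← inv_companionSL_mem (isConjClosed_companionClass_mul _ _), ← Set.mem_inv, mul_inv_rev,
    inv_companionClass, inv_companionClass, neg_neg, neg_neg, companionClass_mul_comm]

theorem one_mem_mul_companionClass {X : Set PSL2R} (hX : IsConjClosed X) (t : ℝ) :
    1 ∈ X * companionClass t ↔ toPSL (companionSL (-t)) ∈ X := by
  constructor
  · rintro ⟨x, hx, y, hy, hxy⟩
    obtain rfl : x = y⁻¹ := eq_inv_of_mul_eq_one_left hxy
    refine hX _ hx _ (isConj_iff_mem_companionClass.2 ?_)
    rw [← inv_companionClass]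
    simpa using hy
  · intro h
    refine ⟨_, h, (toPSL (companionSL (-t)))⁻¹, ?_, by simp⟩
    rw [← Set.mem_inv, inv_companionClass]
    exact companionSL_mem_companionClass _

theorem one_mem_companionClass_mul {s t : ℝ} :
    1 ∈ companionClass s * companionClass t ↔ -t = s ∨ (t = s ∧ 4 < s ^ 2) := by
  rw [one_mem_mul_companionClass (isConjClosed_companionClass s), toPSL_companionSL_mem, neg_inj]

theorem companionClass_eq_iff {s t : ℝ} :
    companionClass s = companionClass t ↔ s = t ∨ (s = -t ∧ 4 < t ^ 2) := by
  rw [← toPSL_companionSL_mem]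
  constructor
  · intro h
    rw [← h]
    exact companionSL_mem_companionClass s
  · exact fun h => (IsConj.conjugatesOf_eq h).symm

/-! ### The classes of the statement as companion classes -/

theorem tildeImage_conjugatesOf (r : SL2R) :
    tildeImage (conjugatesOf r) = conjugatesOf (toPSL r) := by
  apply Set.Subset.antisymm
  · rintro _ ⟨g, hg, rfl⟩
    exact toPSL.map_isConj hg
  · intro z hz
    obtain ⟨c, rfl⟩ := isConj_iff.1 (show IsConj (toPSL r) z from hz)
    obtain ⟨k, rfl⟩ := toPSL_surjective c
    exact ⟨k * r * k⁻¹, isConj_iff.2 ⟨k, rfl⟩, rfl⟩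

theorem tcl2pp_eq : tcl2pp = companionClass 2 := by
  have : parabolicRep 1 1 = sl2 1 0 1 1 (by norm_num) := by
    ext i j; fin_cases i <;> fin_cases j <;> simp [sl2, parabolicRep]
  rw [tcl2pp, cl2, tildeImage_conjugatesOf, this, IsPositive.conjugatesOf_eq, sltr_sl2]
  · norm_num
  · left; simp

theorem tcl2pm_eq : tcl2pm = companionClass (-2) := by
  have : parabolicRep 1 (-1) = -sl2 (-1) 0 1 (-1) (by norm_num) := by
    rw [neg_sl2]
    ext i j; fin_cases i <;> fin_cases j <;> simp [sl2, parabolicRep]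
  rw [tcl2pm, cl2, tildeImage_conjugatesOf, this, toPSL_neg, IsPositive.conjugatesOf_eq, sltr_sl2]
  · norm_num
  · left; simp

theorem rotationRep_eq (α : ℝ) : rotationRep α =
    sl2 (Real.cos α) (-Real.sin α) (Real.sin α) (Real.cos α)
      (by linarith [Real.cos_sq_add_sin_sq α]) := rfl

theorem isPositive_rotationRep {α : ℝ} (hα : α ∈ Set.Ioo 0 Real.pi) :
    IsPositive (rotationRep α) := by
  left
  rw [rotationRep_eq, slskew_sl2]
  linarith [Real.sin_pos_of_mem_Ioo hα]

theorem sltr_rotationRep (α : ℝ) : sltr (rotationRep α) = 2 * Real.cos α := by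
  rw [rotationRep_eq, sltr_sl2]; ring

theorem tcl3_eq {α : ℝ} (hα : α ∈ Set.Ioo 0 Real.pi) :
    tcl3 α = companionClass (2 * Real.cos α) := by
  rw [tcl3, cl3, tildeImage_conjugatesOf, (isPositive_rotationRep hα).conjugatesOf_eq,
    sltr_rotationRep]

theorem four_lt_add_inv_sq {l : ℝ} (hl : 1 < |l|) : 4 < (l + l⁻¹) ^ 2 := by
  have h0 : l ≠ 0 := by rintro rfl; norm_num at hl
  have h1 : 1 < l ^ 2 := by rw [← sq_abs]; nlinarith
  have h2 : l - l⁻¹ ≠ 0 := by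
    intro h
    have : l * (l - l⁻¹) = 0 := by rw [h, mul_zero]
    rw [mul_sub, mul_inv_cancel₀ h0] at this
    linarith
  have h3 : (l + l⁻¹) ^ 2 = 4 + (l - l⁻¹) ^ 2 := by field_simp; ring
  rw [h3]
  have := sq_pos_of_ne_zero h2
  linarith

theorem tcl4_eq {l : ℝˣ} (hl : 1 < |(l : ℝ)|) :
    tcl4 l = companionClass ((l : ℝ) + (l : ℝ)⁻¹) := by
  have : diagonalRep l = sl2 l 0 0 (l : ℝ)⁻¹ (by simp) := by
    ext i j; fin_cases i <;> fin_cases j <;> simp [sl2, diagonalRep]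
  rw [tcl4, cl4, tildeImage_conjugatesOf, this, IsPositive.conjugatesOf_eq, sltr_sl2]
  right
  simpa using four_lt_add_inv_sq hl

theorem exists_add_inv_eq {t : ℝ} (ht : 4 < t ^ 2) : ∃ l : ℝ, 1 < |l| ∧ l + l⁻¹ = t := by
  have key : ∀ t : ℝ, 2 < t → ∃ l : ℝ, 1 < l ∧ l + l⁻¹ = t := by
    intro t ht
    have hs : 0 < t ^ 2 - 4 := by nlinarith
    have hs2 := Real.sq_sqrt hs.le
    have hs0 := Real.sqrt_pos.2 hs
    refine ⟨(t + √(t ^ 2 - 4)) / 2, by linarith, ?_⟩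
    have : ((t + √(t ^ 2 - 4)) / 2)⁻¹ = (t - √(t ^ 2 - 4)) / 2 := by
      apply inv_eq_of_mul_eq_one_right
      linear_combination (-1 / 4) * hs2
    rw [this]; ring
  have habs : 2 < |t| := by
    rw [show (4 : ℝ) = 2 ^ 2 by norm_num, sq_lt_sq] at ht
    simpa using ht
  rcases lt_abs.1 habs with h | h
  · obtain ⟨l, h1, h2⟩ := key t h
    exact ⟨l, lt_of_lt_of_le h1 (le_abs_self l), h2⟩
  · obtain ⟨l, h1, h2⟩ := key (-t) h
    refine ⟨-l, by rw [abs_neg]; exact lt_of_lt_of_le h1 (le_abs_self l), ?_⟩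
    rw [inv_neg]; linarith

theorem exists_tcl4_eq {t : ℝ} (ht : 4 < t ^ 2) :
    ∃ l : ℝˣ, 1 < |(l : ℝ)| ∧ tcl4 l = companionClass t := by
  obtain ⟨l, hl, rfl⟩ := exists_add_inv_eq ht
  have h0 : l ≠ 0 := by rintro rfl; norm_num at hl
  exact ⟨Units.mk0 l h0, hl, tcl4_eq hl⟩

theorem tcl4All_eq : tcl4All = ⋃ (t : ℝ) (_ : 4 < t ^ 2), companionClass t := by
  apply Set.Subset.antisymm
  · refine Set.iUnion₂_subset fun l hl => ?_
    rw [tcl4_eq hl]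
    exact Set.subset_iUnion₂_of_subset _ (four_lt_add_inv_sq hl) subset_rfl
  · refine Set.iUnion₂_subset fun t ht => ?_
    obtain ⟨l, hl, h⟩ := exists_tcl4_eq ht
    rw [← h]
    exact Set.subset_iUnion₂_of_subset l hl subset_rfl

theorem isConjClosed_tcl4All : IsConjClosed tcl4All := by
  rw [tcl4All_eq]
  exact isConjClosed_iUnion fun t => isConjClosed_iUnion fun _ => isConjClosed_companionClass t

theorem companionSL_mem_tcl4All {u : ℝ} : toPSL (companionSL u) ∈ tcl4All ↔ 4 < u ^ 2 := by
  simp only [tcl4All_eq, Set.mem_iUnion, toPSL_companionSL_mem, exists_prop]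
  constructor
  · rintro ⟨t, ht, rfl | ⟨rfl, -⟩⟩
    · exact ht
    · simpa using ht
  · exact fun h => ⟨u, h, Or.inl rfl⟩

theorem one_notMem_tcl4All : 1 ∉ tcl4All := by
  simp only [tcl4All_eq, Set.mem_iUnion, not_exists]
  exact fun t _ => one_notMem_companionClass t

theorem exists_angle {t : ℝ} (ht : t ^ 2 < 4) : ∃ α ∈ Set.Ioo 0 Real.pi, t = 2 * Real.cos α := by
  have h := abs_lt.1 (abs_lt_of_sq_lt_sq (show t ^ 2 < 2 ^ 2 by linarith) (by norm_num))
  refine ⟨Real.arccos (t / 2), ⟨Real.arccos_pos.2 (by linarith), ?_⟩, ?_⟩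
  · refine lt_of_le_of_ne (Real.arccos_le_pi _) fun h' => ?_
    have := Real.arccos_eq_pi.1 h'
    linarith
  · rw [Real.cos_arccos] <;> linarith

theorem isConjClosed_iUnion_tcl3 {s : Set ℝ} : IsConjClosed (⋃ γ ∈ s, tcl3 γ) := by
  refine isConjClosed_iUnion fun γ => isConjClosed_iUnion fun _ => ?_
  rw [tcl3, cl3, tildeImage_conjugatesOf]
  exact isConjClosed_conjugatesOf _

theorem companionSL_mem_iUnion_tcl3 {s : Set ℝ} (hs : s ⊆ Set.Ioo 0 Real.pi) {u : ℝ} :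
    toPSL (companionSL u) ∈ ⋃ γ ∈ s, tcl3 γ ↔ ∃ γ ∈ s, u = 2 * Real.cos γ := by
  simp only [Set.mem_iUnion, exists_prop]
  refine exists_congr fun γ => and_congr_right fun hγ => ?_
  rw [tcl3_eq (hs hγ), toPSL_companionSL_mem, or_iff_left]
  rintro ⟨-, h⟩
  nlinarith [Real.cos_sq_add_sin_sq γ, sq_nonneg (Real.sin γ)]

theorem one_notMem_iUnion_tcl3 {s : Set ℝ} (hs : s ⊆ Set.Ioo 0 Real.pi) :
    1 ∉ ⋃ γ ∈ s, tcl3 γ := by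
  simp only [Set.mem_iUnion, not_exists]
  intro γ hγ
  rw [tcl3_eq (hs hγ)]
  exact one_notMem_companionClass _

/-! ### Products with a parabolic class -/

/-- If the trace is at most `2` in absolute value, then `b c = a d - 1 ≤ 0` by the
arithmetic-geometric mean inequality; together with `b < c` this fixes both signs. -/
theorem IsPositive.entries_sign {a b c d : ℝ} {h : a * d - b * c = 1}
    (hg : IsPositive (sl2 a b c d h)) (ht : (a + d) ^ 2 ≤ 4) : b ≤ 0 ∧ 0 ≤ c := by
  have hs : 0 < c - b := hg.resolve_right (not_lt.2 ht)
  have hbc : b * c ≤ 0 := by nlinarith [sq_nonneg (a - d)]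
  constructor
  · by_contra hb
    nlinarith
  · by_contra hc
    nlinarith

theorem companionSL_mem_parabolic_mul_of_lt {t u : ℝ} (htu : u < t) :
    toPSL (companionSL u) ∈ companionClass 2 * companionClass t := by
  have hb : u - t ≠ 0 := by linarith
  have hc : 0 < (t - u)⁻¹ := inv_pos.2 (by linarith)
  have hbc : (u - t) * (t - u)⁻¹ = -1 := by
    have : t - u ≠ 0 := by linarith
    field_simp; ring
  -- Multiplication by this unipotent matrix adds the upper right entry of `y` to the trace, so that
  -- entry has to be `u - t`.
  have h := companionSL_mem_mul (r := sl2 1 0 1 1 (by norm_num))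
    (y := sl2 0 (u - t) (t - u)⁻¹ t (by linarith))
    (Or.inl (by simp)) (Or.inl (by simp; linarith))
    (Or.inl (by rw [sl2_mul]; simp; linarith))
  rw [sl2_mul] at h
  simpa [one_add_one_eq_two] using h

theorem companionSL_mem_parabolic_mul_of_two_lt {t u : ℝ} (ht : t ^ 2 ≤ 4) (hu : 2 < u) :
    toPSL (companionSL u) ∈ companionClass 2 * companionClass t := by
  rw [← companionSL_neg_mem_iff (isConjClosed_companionClass_mul _ _) (by nlinarith)]
  exact companionSL_mem_parabolic_mul_of_lt (by nlinarith)

theorem companionSL_mem_parabolic_mul_self (u : ℝ) :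
    toPSL (companionSL u) ∈ companionClass 2 * companionClass 2 := by
  rcases lt_trichotomy u 2 with hu | rfl | hu
  · exact companionSL_mem_parabolic_mul_of_lt hu
  · have h := companionSL_mem_mul (r := sl2 1 0 1 1 (by norm_num))
      (y := sl2 1 0 1 1 (by norm_num)) (Or.inl (by simp)) (Or.inl (by simp))
      (Or.inl (by rw [sl2_mul]; simp))
    rw [sl2_mul] at h
    simpa [one_add_one_eq_two] using h
  · exact companionSL_mem_parabolic_mul_of_two_lt (by norm_num) hu

theorem companionSL_mem_parabolic_mul_opposite {u : ℝ} :
    toPSL (companionSL u) ∈ companionClass 2 * companionClass (-2) ↔ 4 ≤ u ^ 2 := by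
  constructor
  · have h := companionSL_mem_mul_iff (r := sl2 1 0 1 1 (by norm_num)) (t := -2) (u := u)
      (Or.inl (by simp))
    rw [sltr_sl2, one_add_one_eq_two] at h
    rw [h]
    rintro ⟨y, hyt, hy, hm⟩
    obtain ⟨a, b, c, d, hd, rfl⟩ := exists_eq_sl2 y
    rw [sltr_sl2] at hyt
    -- The product has trace `b - 2 ≤ -2`.
    have hb := (hy.entries_sign (by rw [hyt]; norm_num)).1
    rw [sl2_mul, toPSL_mem_companionClass, sltr_sl2] at hm
    rcases hm with ⟨rfl, -⟩ | ⟨hm, -⟩ <;> nlinarith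
  · intro hu
    rcases hu.lt_or_eq with hu | hu
    · rcases lt_or_gt_of_ne (show u ≠ 0 by rintro rfl; norm_num at hu) with h | h
      · exact companionSL_mem_parabolic_mul_of_lt (by nlinarith)
      · exact companionSL_mem_parabolic_mul_of_two_lt (by norm_num) (by nlinarith)
    -- The boundary value `-2` comes from two parabolic factors fixing the same line; the value `2`
    -- follows by inversion.
    · have h1 := companionSL_mem_mul (r := sl2 1 0 1 1 (by norm_num))
        (y := sl2 (-1) 0 2 (-1) (by norm_num)) (Or.inl (by simp)) (Or.inl (by simp))
        (Or.inl (by rw [sl2_mul]; simp))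
      rw [sl2_mul] at h1
      have h3 : toPSL (companionSL (-2)) ∈ companionClass 2 * companionClass (-2) := by
        norm_num at h1
        exact h1
      have : u = 2 ∨ u = -2 := sq_eq_sq_iff_eq_or_eq_neg.1 (by linarith)
      rcases this with rfl | rfl
      · rwa [← companionSL_neg_mem_mul_neg, neg_neg, companionClass_mul_comm]
      · exact h3

theorem companionSL_mem_parabolic_mul_elliptic {t u : ℝ} (ht : t ^ 2 < 4) :
    toPSL (companionSL u) ∈ companionClass 2 * companionClass t ↔ u < t ∨ 2 < u := by
  constructor
  · have h := companionSL_mem_mul_iff (r := sl2 1 0 1 1 (by norm_num)) (t := t) (u := u)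
      (Or.inl (by simp))
    rw [sltr_sl2, one_add_one_eq_two] at h
    rw [h]
    rintro ⟨y, rfl, hy, hm⟩
    obtain ⟨a, b, c, d, hd, rfl⟩ := exists_eq_sl2 y
    rw [sltr_sl2] at ht
    obtain ⟨hb, hc⟩ := hy.entries_sign ht.le
    have hb' : b ≠ 0 := by
      rintro rfl
      nlinarith [sq_nonneg (a - d)]
    have hb0 : b < 0 := lt_of_le_of_ne hb hb'
    rw [sl2_mul, toPSL_mem_companionClass, sltr_sl2, slskew_sl2] at hm
    rw [sltr_sl2]
    rcases hm with ⟨hu, -⟩ | ⟨hu, hm⟩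
    · left; linarith
    by_cases hu4 : 4 < u ^ 2
    · by_cases hu0 : 0 < u
      · right; nlinarith
      · left; nlinarith
    -- The remaining case is a non-hyperbolic product with negative skew. Its off-diagonal entries
    -- `b` and `a + c` have product at most `0` since its trace is bounded by `2`, while negative
    -- skew gives `a + c < b < 0`.
    exfalso
    have hs := hm.resolve_right hu4
    have : b * (a + c) ≤ 0 := by
      have : (a + b + d) ^ 2 ≤ 4 := by
        rw [show a + b + d = -u by linarith, neg_sq]; linarith
      nlinarith [sq_nonneg (a - (b + d))]
    have : a + c < 0 := by linarith
    nlinarith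
  · rintro (h | h)
    · exact companionSL_mem_parabolic_mul_of_lt h
    · exact companionSL_mem_parabolic_mul_of_two_lt ht.le h

/-! ### Products with a hyperbolic class -/

theorem companionSL_mem_hyperbolic_mul {s : ℝ} (hs : 4 < s ^ 2) (t u : ℝ) :
    toPSL (companionSL u) ∈ companionClass s * companionClass t := by
  obtain ⟨l, hl, rfl⟩ := exists_add_inv_eq hs
  wlog hl0 : 0 < l generalizing l
  · have h := this (-l) (by rwa [abs_neg]) (by rwa [inv_neg, ← neg_add, neg_sq])
      (by
        have : l ≠ 0 := by rintro rfl; norm_num at hl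
        have := lt_of_le_of_ne (not_lt.1 hl0) this
        linarith)
    rwa [inv_neg, ← neg_add, companionClass_neg hs] at h
  have hl1 : 1 < l := by rwa [abs_of_pos hl0] at hl
  have hinv : l * l⁻¹ = 1 := mul_inv_cancel₀ hl0.ne'
  have hinv0 : 0 < l⁻¹ := inv_pos.2 hl0
  have hinv1 : l⁻¹ < 1 := inv_lt_one_of_one_lt₀ hl1
  -- The solution of `l a + l⁻¹ (t - a) = u`: with diagonal `(a, t - a)`, `y` has trace `t` and its
  -- product with the diagonal matrix has trace `u`. The upper right entry `-1` serves to make both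
  -- positive.
  set a := (u - t * l⁻¹) / (l - l⁻¹) with ha
  have hta : l * a + l⁻¹ * (t - a) = u := by
    have : a * (l - l⁻¹) = u - t * l⁻¹ := div_mul_cancel₀ _ (by linarith)
    linarith
  have h := companionSL_mem_mul (r := sl2 l 0 0 l⁻¹ (by linarith))
    (y := sl2 a (-1) (1 - a * (t - a)) (t - a) (by ring)) (Or.inr (by simpa using hs)) ?_ ?_
  · rw [sl2_mul] at h
    simpa [hta] using h
  · rw [IsPositive, sltr_sl2, slskew_sl2]
    by_cases ht : 4 < t ^ 2
    · right; simpa using ht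
    · left; nlinarith [sq_nonneg (t - 2 * a)]
  · rw [sl2_mul, IsPositive, sltr_sl2, slskew_sl2]
    by_cases hu : 4 < u ^ 2
    · right; simpa [hta] using hu
    · left
      -- Both matrices have the same product of diagonal entries, so the bound on `u` controls it.
      have hle : a * (t - a) ≤ 1 := by
        have : a * (t - a) = (l * a) * (l⁻¹ * (t - a)) := by
          linear_combination (-(a * (t - a))) * hinv
        rw [this]
        rw [← hta] at hu
        nlinarith [sq_nonneg (l * a - l⁻¹ * (t - a))]
      have : 0 ≤ l⁻¹ * (1 - a * (t - a)) := mul_nonneg hinv0.le (by linarith)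
      linarith

/-! ### Products of two elliptic classes -/

theorem companionSL_mem_elliptic_mul_iff {α t u : ℝ} (hα : α ∈ Set.Ioo 0 Real.pi) :
    toPSL (companionSL u) ∈ companionClass (2 * Real.cos α) * companionClass t ↔
      ∃ y, sltr y = t ∧ IsPositive y ∧ toPSL (rotationRep α * y) ∈ companionClass u := by
  rw [← sltr_rotationRep, companionSL_mem_mul_iff (isPositive_rotationRep hα)]

theorem sltr_rotationRep_mul (α : ℝ) (y : SL2R) : sltr (rotationRep α * y) =
    Real.cos α * sltr y - Real.sin α * slskew y := by
  obtain ⟨a, b, c, d, h, rfl⟩ := exists_eq_sl2 y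
  rw [rotationRep_eq, sl2_mul]
  simp only [sltr_sl2, slskew_sl2]
  ring

theorem slskew_rotationRep_mul (α : ℝ) (y : SL2R) : slskew (rotationRep α * y) =
    Real.cos α * slskew y + Real.sin α * sltr y := by
  obtain ⟨a, b, c, d, h, rfl⟩ := exists_eq_sl2 y
  rw [rotationRep_eq, sl2_mul]
  simp only [sltr_sl2, slskew_sl2]
  ring

/-- The difference of the two sides is `(b + c)² + (a - d)²`. -/
theorem four_le_slskew_sq_add_sltr_sq (y : SL2R) : 4 ≤ slskew y ^ 2 + sltr y ^ 2 := by
  obtain ⟨a, b, c, d, h, rfl⟩ := exists_eq_sl2 y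
  simp only [sltr_sl2, slskew_sl2]
  nlinarith [sq_nonneg (b + c), sq_nonneg (a - d)]

theorem IsPositive.two_mul_sin_le_slskew {β : ℝ} (hβ : β ∈ Set.Ioo 0 Real.pi) {y : SL2R}
    (hy : IsPositive y) (ht : sltr y = 2 * Real.cos β) : 2 * Real.sin β ≤ slskew y := by
  have hsin := Real.sin_pos_of_mem_Ioo hβ
  have h1 := Real.cos_sq_add_sin_sq β
  have h2 := four_le_slskew_sq_add_sltr_sq y
  rw [IsPositive, ht] at hy
  have h3 : 0 < slskew y := hy.resolve_right (by nlinarith)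
  rw [ht] at h2
  exact abs_le_of_sq_le_sq' (by linarith) h3.le |>.2

theorem exists_isPositive_sltr_slskew {β m : ℝ} (hβ : β ∈ Set.Ioo 0 Real.pi)
    (hm : 2 * Real.sin β ≤ m) :
    ∃ y, IsPositive y ∧ sltr y = 2 * Real.cos β ∧ slskew y = m := by
  have hsin := Real.sin_pos_of_mem_Ioo hβ
  have h1 := Real.cos_sq_add_sin_sq β
  have hs : 0 ≤ m ^ 2 - 4 * Real.sin β ^ 2 := by nlinarith
  have hs2 := Real.sq_sqrt hs
  -- With equal diagonal entries `cos β` and skew `m`, determinant one forces the sum `q` of the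
  -- off-diagonal entries up to sign.
  set q := √(m ^ 2 - 4 * Real.sin β ^ 2)
  refine ⟨sl2 (Real.cos β) ((q - m) / 2) ((q + m) / 2) (Real.cos β) ?_, Or.inl ?_, ?_, ?_⟩
  · linear_combination h1 - hs2 / 4
  · rw [slskew_sl2]; linarith
  · rw [sltr_sl2]; ring
  · rw [slskew_sl2]; ring

theorem companionSL_mem_elliptic_mul_of_le {α β u : ℝ} (hα : α ∈ Set.Ioo 0 Real.pi)
    (hβ : β ∈ Set.Ioo 0 Real.pi) (hu : u ≤ 2 * Real.cos (α + β))
    (hpos : ∀ y, sltr y = 2 * Real.cos β → IsPositive y → sltr (rotationRep α * y) = u →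
      IsPositive (rotationRep α * y)) :
    toPSL (companionSL u) ∈
      companionClass (2 * Real.cos α) * companionClass (2 * Real.cos β) := by
  have hsin := Real.sin_pos_of_mem_Ioo hα
  -- This `m` solves `2 cos α cos β - m sin α = u`; the bound on `u` says precisely that `m ≥ 2 sin
  -- β`.
  obtain ⟨y, hy, hyt, hys⟩ := exists_isPositive_sltr_slskew (β := β)
    (m := (2 * Real.cos α * Real.cos β - u) / Real.sin α) hβ
    (by rw [le_div_iff₀ hsin]; rw [Real.cos_add] at hu; linarith)
  have htr : sltr (rotationRep α * y) = u := by
    rw [sltr_rotationRep_mul, hyt, hys, mul_div_cancel₀ _ hsin.ne']; ring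
  rw [companionSL_mem_elliptic_mul_iff hα]
  refine ⟨y, hyt, hy, ?_⟩
  have := (hpos y hyt hy htr).conjugatesOf_eq
  rw [htr] at this
  rw [← this]
  exact mem_conjugatesOf_self

theorem sltr_rotationRep_mul_le {α β : ℝ} (hα : α ∈ Set.Ioo 0 Real.pi)
    (hβ : β ∈ Set.Ioo 0 Real.pi) {y : SL2R} (hyt : sltr y = 2 * Real.cos β) (hy : IsPositive y) :
    sltr (rotationRep α * y) ≤ 2 * Real.cos (α + β) := by
  have := mul_le_mul_of_nonneg_left (hy.two_mul_sin_le_slskew hβ hyt)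
    (Real.sin_pos_of_mem_Ioo hα).le
  rw [sltr_rotationRep_mul, hyt, Real.cos_add]
  linarith

/-- If `cos α ≥ 0`, the skew of the product is at least `2 sin (α + β)`. If `cos α < 0`, its
multiple by `sin α` equals `2 cos β - cos α · tr`, which is at least `2 (cos β + cos α) > 0` because
the trace is at least `-2` and `β < π - α`. -/
theorem slskew_rotationRep_mul_pos {α β : ℝ} (hα : α ∈ Set.Ioo 0 Real.pi)
    (hβ : β ∈ Set.Ioo 0 Real.pi) (hαβ : α + β < Real.pi) {y : SL2R}
    (hyt : sltr y = 2 * Real.cos β) (hy : IsPositive y)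
    (h : -2 ≤ sltr (rotationRep α * y)) : 0 < slskew (rotationRep α * y) := by
  have hsα := Real.sin_pos_of_mem_Ioo hα
  have hm := hy.two_mul_sin_le_slskew hβ hyt
  rw [slskew_rotationRep_mul, hyt]
  rw [sltr_rotationRep_mul, hyt] at h
  rcases le_or_gt 0 (Real.cos α) with hc | hc
  · have h1 := Real.sin_pos_of_pos_of_lt_pi (add_pos hα.1 hβ.1) hαβ
    rw [Real.sin_add] at h1
    have := mul_le_mul_of_nonneg_left hm hc
    linarith
  · have h1 : Real.cos (Real.pi - α) < Real.cos β :=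
      Real.cos_lt_cos_of_nonneg_of_le_pi hβ.1.le (by linarith [hα.1]) (by linarith)
    rw [Real.cos_pi_sub] at h1
    have h2 := mul_le_mul_of_nonpos_left h hc.le
    have h3 := Real.cos_sq_add_sin_sq α
    refine (mul_pos_iff_of_pos_left hsα).1 ?_
    have : Real.sin α * (Real.cos α * slskew y + Real.sin α * (2 * Real.cos β)) =
      2 * Real.cos β
        - Real.cos α * (Real.cos α * (2 * Real.cos β) - Real.sin α * slskew y) := by
      linear_combination (2 * Real.cos β) * h3
    rw [this]
    linarith

theorem companionSL_mem_elliptic_mul_of_add_lt {α β u : ℝ} (hα : α ∈ Set.Ioo 0 Real.pi)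
    (hβ : β ∈ Set.Ioo 0 Real.pi) (hαβ : α + β < Real.pi) :
    toPSL (companionSL u) ∈ companionClass (2 * Real.cos α) * companionClass (2 * Real.cos β) ↔
      u ≤ 2 * Real.cos (α + β) ∨ 2 < u := by
  have hle : ∀ u ≤ 2 * Real.cos (α + β), toPSL (companionSL u) ∈
      companionClass (2 * Real.cos α) * companionClass (2 * Real.cos β) := by
    intro u hu
    refine companionSL_mem_elliptic_mul_of_le hα hβ hu fun y hyt hy htr => ?_
    rw [IsPositive]
    rcases le_or_gt (-2) u with h | h
    · exact Or.inl (slskew_rotationRep_mul_pos hα hβ hαβ hyt hy (by rwa [htr]))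
    · right; rw [htr]; nlinarith
  constructor
  · rw [companionSL_mem_elliptic_mul_iff hα]
    rintro ⟨y, hyt, hy, hm⟩
    have h1 := sltr_rotationRep_mul_le hα hβ hyt hy
    rw [toPSL_mem_companionClass] at hm
    rcases hm with ⟨hu, -⟩ | ⟨hu, hm⟩
    · left; linarith
    by_cases hu2 : 2 < u
    · exact Or.inr hu2
    -- Here the product has trace `-u ≥ -2`, hence positive skew, so the negative lift is possible
    -- only with `u² > 4`, that is `u < -2`.
    have h2 := slskew_rotationRep_mul_pos hα hβ hαβ hyt hy (by linarith)
    have h3 : 4 < u ^ 2 := hm.resolve_left (by linarith)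
    left
    nlinarith [Real.neg_one_le_cos (α + β)]
  · rintro (h | h)
    · exact hle u h
    · rw [← companionSL_neg_mem_iff (isConjClosed_companionClass_mul _ _) (by nlinarith)]
      exact hle _ (by linarith [Real.neg_one_le_cos (α + β)])

theorem companionSL_mem_elliptic_mul_of_add_eq {α β u : ℝ} (hα : α ∈ Set.Ioo 0 Real.pi)
    (hβ : β ∈ Set.Ioo 0 Real.pi) (hαβ : α + β = Real.pi) :
    toPSL (companionSL u) ∈ companionClass (2 * Real.cos α) * companionClass (2 * Real.cos β) ↔
      4 < u ^ 2 := by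
  have hle : ∀ u < -2, toPSL (companionSL u) ∈
      companionClass (2 * Real.cos α) * companionClass (2 * Real.cos β) := by
    intro u hu
    refine companionSL_mem_elliptic_mul_of_le hα hβ ?_ fun y hyt hy htr => ?_
    · rw [hαβ, Real.cos_pi]; linarith
    · right; rw [htr]; nlinarith
  constructor
  · rw [companionSL_mem_elliptic_mul_iff hα]
    rintro ⟨y, hyt, hy, hm⟩
    have h1 := sltr_rotationRep_mul_le hα hβ hyt hy
    have hsα := Real.sin_pos_of_mem_Ioo hα
    obtain rfl : β = Real.pi - α := by linarith
    rw [hαβ, Real.cos_pi] at h1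
    by_contra hu
    -- The trace is at most `-2`, and at equality the skew vanishes, so the product is `-1` and lies
    -- in no nontrivial class.
    have key : ∀ v, sltr (rotationRep α * y) = v → v ^ 2 ≤ 4 →
        slskew (rotationRep α * y) = 0 := by
      rintro v rfl hv
      have h2 : sltr (rotationRep α * y) = -2 := by nlinarith
      have h3 := Real.cos_sq_add_sin_sq α
      rw [sltr_rotationRep_mul, hyt, Real.cos_pi_sub] at h2
      have h4 : Real.sin α * (slskew y - 2 * Real.sin α) = 0 := by
        linear_combination -h2 - 2 * h3
      have h5 : slskew y = 2 * Real.sin α :=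
        sub_eq_zero.1 ((mul_eq_zero.1 h4).resolve_left hsα.ne')
      rw [slskew_rotationRep_mul, hyt, h5, Real.cos_pi_sub]
      ring
    rw [toPSL_mem_companionClass] at hm
    rcases hm with ⟨h, hm⟩ | ⟨h, hm⟩
    · have := key _ h (by linarith)
      have := hm.resolve_right hu
      linarith
    · have := key _ h (by linarith [neg_sq u])
      have := hm.resolve_right hu
      linarith
  · intro hu
    rcases lt_or_gt_of_ne (show u ≠ 0 by rintro rfl; norm_num at hu) with h | h
    · exact hle u (by nlinarith)
    · rw [← companionSL_neg_mem_iff (isConjClosed_companionClass_mul _ _) hu]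
      exact hle _ (by nlinarith)

theorem companionSL_mem_elliptic_mul_of_lt_add {α β u : ℝ} (hα : α ∈ Set.Ioo 0 Real.pi)
    (hβ : β ∈ Set.Ioo 0 Real.pi) (hαβ : Real.pi < α + β) :
    toPSL (companionSL u) ∈ companionClass (2 * Real.cos α) * companionClass (2 * Real.cos β) ↔
      2 * Real.cos (α + β - Real.pi) ≤ u ∨ u < -2 := by
  rw [← companionSL_neg_mem_mul_neg, ← mul_neg, ← mul_neg, ← Real.cos_pi_sub, ← Real.cos_pi_sub,
    companionSL_mem_elliptic_mul_of_add_lt (by constructor <;> linarith [hα.1, hα.2])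
      (by constructor <;> linarith [hβ.1, hβ.2]) (by linarith)]
  rw [show Real.pi - α + (Real.pi - β) = Real.pi - (α + β - Real.pi) by ring, Real.cos_pi_sub]
  exact or_congr (by constructor <;> intro <;> linarith) (by constructor <;> intro <;> linarith)

theorem companionSL_mem_negParabolic_mul_elliptic {t u : ℝ} (ht : t ^ 2 < 4) :
    toPSL (companionSL u) ∈ companionClass (-2) * companionClass t ↔ t < u ∨ u < -2 := by
  have := companionSL_mem_parabolic_mul_elliptic (t := -t) (u := -u) (by simpa using ht)
  rw [← companionSL_neg_mem_mul_neg, neg_neg, this]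
  exact or_congr neg_lt_neg_iff lt_neg

theorem companionSL_mem_negParabolic_mul_self (u : ℝ) :
    toPSL (companionSL u) ∈ companionClass (-2) * companionClass (-2) := by
  rw [← companionSL_neg_mem_mul_neg, neg_neg]
  exact companionSL_mem_parabolic_mul_self _

/-! ### Translation between angle intervals and trace intervals -/

theorem sq_two_mul_cos_lt {α : ℝ} (hα : α ∈ Set.Ioo 0 Real.pi) : (2 * Real.cos α) ^ 2 < 4 := by
  nlinarith [Real.cos_sq_add_sin_sq α, Real.sin_pos_of_mem_Ioo hα]

theorem neg_two_lt_two_mul_cos {α : ℝ} (hα : α ∈ Set.Ioo 0 Real.pi) : -2 < 2 * Real.cos α := by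
  nlinarith [sq_two_mul_cos_lt hα]

theorem two_mul_cos_lt_two {α : ℝ} (hα : α ∈ Set.Ioo 0 Real.pi) : 2 * Real.cos α < 2 := by
  nlinarith [sq_two_mul_cos_lt hα]

theorem exists_two_mul_cos_iff {s : Set ℝ} (hs : s ⊆ Set.Icc 0 Real.pi) {u : ℝ} {p : Prop}
    (hp : p → -2 ≤ u ∧ u ≤ 2)
    (h : ∀ γ ∈ Set.Icc 0 Real.pi, u = 2 * Real.cos γ → (γ ∈ s ↔ p)) :
    (∃ γ ∈ s, u = 2 * Real.cos γ) ↔ p := by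
  constructor
  · rintro ⟨γ, hγ, hu⟩
    exact (h γ (hs hγ) hu).1 hγ
  · intro h'
    obtain ⟨h1, h2⟩ := hp h'
    have hu : u = 2 * Real.cos (Real.arccos (u / 2)) := by
      rw [Real.cos_arccos] <;> linarith
    exact ⟨_, (h _ ⟨Real.arccos_nonneg _, Real.arccos_le_pi _⟩ hu).2 h', hu⟩

theorem two_mul_cos_lt_iff {α β : ℝ} (hα : α ∈ Set.Icc 0 Real.pi) (hβ : β ∈ Set.Icc 0 Real.pi) :
    2 * Real.cos α < 2 * Real.cos β ↔ β < α := by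
  rw [mul_lt_mul_iff_right₀ two_pos, Real.strictAntiOn_cos.lt_iff_gt hα hβ]

theorem two_mul_cos_le_iff {α β : ℝ} (hα : α ∈ Set.Icc 0 Real.pi) (hβ : β ∈ Set.Icc 0 Real.pi) :
    2 * Real.cos α ≤ 2 * Real.cos β ↔ β ≤ α := by
  rw [← not_lt, two_mul_cos_lt_iff hβ hα, not_lt]

theorem exists_cos_mem_Ioo_pi {α u : ℝ} (hα : α ∈ Set.Ioo 0 Real.pi) :
    (∃ γ ∈ Set.Ioo α Real.pi, u = 2 * Real.cos γ) ↔ -2 < u ∧ u < 2 * Real.cos α := by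
  have hα' := Set.Ioo_subset_Icc_self hα
  refine exists_two_mul_cos_iff (fun γ h => ⟨(hα.1.trans h.1).le, h.2.le⟩)
    (fun h => ⟨h.1.le, by linarith [h.2, two_mul_cos_lt_two hα]⟩) ?_
  rintro γ hγ rfl
  have h := two_mul_cos_lt_iff (Set.right_mem_Icc.2 Real.pi_pos.le) hγ
  rw [Real.cos_pi, mul_neg_one] at h
  rw [two_mul_cos_lt_iff hγ hα', h]
  exact and_comm

theorem exists_cos_mem_Ioo_zero {α u : ℝ} (hα : α ∈ Set.Ioo 0 Real.pi) :
    (∃ γ ∈ Set.Ioo 0 α, u = 2 * Real.cos γ) ↔ 2 * Real.cos α < u ∧ u < 2 := by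
  have hα' := Set.Ioo_subset_Icc_self hα
  refine exists_two_mul_cos_iff (fun γ h => ⟨h.1.le, (h.2.trans hα.2).le⟩)
    (fun h => ⟨by linarith [h.1, neg_two_lt_two_mul_cos hα], h.2.le⟩) ?_
  rintro γ hγ rfl
  have h := two_mul_cos_lt_iff hγ (Set.left_mem_Icc.2 Real.pi_pos.le)
  rw [Real.cos_zero, mul_one] at h
  rw [two_mul_cos_lt_iff hα' hγ, h]
  exact and_comm

theorem exists_cos_mem_Ico_pi {α u : ℝ} (hα : α ∈ Set.Ioo 0 Real.pi) :
    (∃ γ ∈ Set.Ico α Real.pi, u = 2 * Real.cos γ) ↔ -2 < u ∧ u ≤ 2 * Real.cos α := by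
  have hα' := Set.Ioo_subset_Icc_self hα
  refine exists_two_mul_cos_iff (fun γ h => ⟨(hα.1.trans_le h.1).le, h.2.le⟩)
    (fun h => ⟨h.1.le, by linarith [h.2, two_mul_cos_lt_two hα]⟩) ?_
  rintro γ hγ rfl
  have h := two_mul_cos_lt_iff (Set.right_mem_Icc.2 Real.pi_pos.le) hγ
  rw [Real.cos_pi, mul_neg_one] at h
  rw [two_mul_cos_le_iff hγ hα', h]
  exact and_comm

theorem exists_cos_mem_Ioc_zero {α u : ℝ} (hα : α ∈ Set.Ioo 0 Real.pi) :
    (∃ γ ∈ Set.Ioc 0 α, u = 2 * Real.cos γ) ↔ 2 * Real.cos α ≤ u ∧ u < 2 := by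
  have hα' := Set.Ioo_subset_Icc_self hα
  refine exists_two_mul_cos_iff (fun γ h => ⟨h.1.le, (h.2.trans_lt hα.2).le⟩)
    (fun h => ⟨by linarith [h.1, neg_two_lt_two_mul_cos hα], h.2.le⟩) ?_
  rintro γ hγ rfl
  have h := two_mul_cos_lt_iff hγ (Set.left_mem_Icc.2 Real.pi_pos.le)
  rw [Real.cos_zero, mul_one] at h
  rw [two_mul_cos_le_iff hα' hγ, h]
  exact and_comm

/-! ### The double product formulas -/

theorem companionSL_mem_companionClass_of_sq_le {u t : ℝ} (ht : t ^ 2 ≤ 4) :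
    toPSL (companionSL u) ∈ companionClass t ↔ u = t := by
  rw [toPSL_companionSL_mem, or_iff_left]
  exact fun h => absurd h.2 (not_lt.2 ht)

theorem companionClass_mul_eq_compl_one {s t : ℝ}
    (h1 : 1 ∉ companionClass s * companionClass t)
    (h : ∀ u, toPSL (companionSL u) ∈ companionClass s * companionClass t) :
    companionClass s * companionClass t = {1}ᶜ :=
  Set.Subset.antisymm (Set.subset_compl_singleton_iff.2 h1)
    ((isConjClosed_companionClass_mul s t).compl_one_subset h)

theorem eq_univ_of_compl_one_subset {X : Set PSL2R} (h : {1}ᶜ ⊆ X) (h1 : 1 ∈ X) :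
    X = Set.univ := by
  refine Set.eq_univ_of_forall fun z => ?_
  by_cases hz : z = 1
  · rwa [hz]
  · exact h hz

theorem four_lt_sq_iff {u : ℝ} : 4 < u ^ 2 ↔ u < -2 ∨ 2 < u := by
  constructor
  · intro h
    by_contra hc
    push Not at hc
    nlinarith
  · rintro (h | h) <;> nlinarith

theorem tcl4_mul_self {l : ℝˣ} (hl : 1 < |(l : ℝ)|) : tcl4 l * tcl4 l = Set.univ := by
  have h4 := four_lt_add_inv_sq hl
  rw [tcl4_eq hl]
  exact eq_univ_of_compl_one_subset ((isConjClosed_companionClass_mul _ _).compl_one_subset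
    (companionSL_mem_hyperbolic_mul h4 _)) (one_mem_companionClass_mul.2 (Or.inr ⟨rfl, h4⟩))

theorem tcl4_mul_of_ne {l : ℝˣ} (hl : 1 < |(l : ℝ)|) {X : Set PSL2R} (hX : IsNontrivialClass X)
    (hne : X ≠ tcl4 l) : tcl4 l * X = {1}ᶜ := by
  have h4 := four_lt_add_inv_sq hl
  obtain ⟨t, rfl⟩ := isNontrivialClass_iff.1 hX
  rw [tcl4_eq hl] at hne ⊢
  refine companionClass_mul_eq_compl_one (fun h => hne ?_) (companionSL_mem_hyperbolic_mul h4 t)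
  rw [companionClass_eq_iff]
  rcases one_mem_companionClass_mul.1 h with h | h
  · exact Or.inr ⟨by linarith, h4⟩
  · exact Or.inl h.1

theorem tcl2pp_mul_self : tcl2pp * tcl2pp = {1}ᶜ := by
  rw [tcl2pp_eq]
  refine companionClass_mul_eq_compl_one ?_ companionSL_mem_parabolic_mul_self
  rw [one_mem_companionClass_mul]
  norm_num

theorem tcl2pm_mul_self : tcl2pm * tcl2pm = {1}ᶜ := by
  rw [tcl2pm_eq]
  refine companionClass_mul_eq_compl_one ?_ companionSL_mem_negParabolic_mul_self
  rw [one_mem_companionClass_mul]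
  norm_num

theorem tcl2pp_mul_tcl2pm : tcl2pp * tcl2pm = {1} ∪ tcl2pp ∪ tcl2pm ∪ tcl4All := by
  rw [tcl2pp_eq, tcl2pm_eq]
  refine (isConjClosed_companionClass_mul _ _).ext_companionSL
    (((isConjClosed_one.union (isConjClosed_companionClass _)).union
      (isConjClosed_companionClass _)).union isConjClosed_tcl4All) ?_ fun u => ?_
  · simp [one_mem_companionClass_mul]
  · have h1 : toPSL (companionSL u) ≠ 1 := fun h =>
      one_notMem_companionClass u (h ▸ companionSL_mem_companionClass u)
    rw [companionSL_mem_parabolic_mul_opposite, Set.mem_union, Set.mem_union, Set.mem_union,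
      companionSL_mem_tcl4All, companionSL_mem_companionClass_of_sq_le (by norm_num),
      companionSL_mem_companionClass_of_sq_le (by norm_num), Set.mem_singleton_iff,
      or_iff_right h1, le_iff_lt_or_eq, or_comm]
    refine or_congr_left ?_
    rw [eq_comm, show (4 : ℝ) = 2 ^ 2 by norm_num, sq_eq_sq_iff_eq_or_eq_neg]

theorem tcl2pp_mul_tcl3 {α : ℝ} (hα : α ∈ Set.Ioo 0 Real.pi) :
    tcl2pp * tcl3 α = (⋃ γ ∈ Set.Ioo α Real.pi, tcl3 γ) ∪ tcl2pm ∪ tcl4All := by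
  have hs : Set.Ioo α Real.pi ⊆ Set.Ioo 0 Real.pi := Set.Ioo_subset_Ioo_left hα.1.le
  have h1 := neg_two_lt_two_mul_cos hα
  have h2 := two_mul_cos_lt_two hα
  rw [tcl2pp_eq, tcl2pm_eq, tcl3_eq hα]
  refine (isConjClosed_companionClass_mul _ _).ext_companionSL
    ((isConjClosed_iUnion_tcl3.union (isConjClosed_companionClass _)).union
      isConjClosed_tcl4All) ?_ fun u => ?_
  · rw [Set.mem_union, Set.mem_union, one_mem_companionClass_mul]
    simp only [one_notMem_iUnion_tcl3 hs, one_notMem_companionClass, one_notMem_tcl4All, or_false,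
      iff_false, not_or]
    constructor
    · intro; linarith
    · norm_num
  · rw [Set.mem_union, Set.mem_union, companionSL_mem_iUnion_tcl3 hs, exists_cos_mem_Ioo_pi hα,
      companionSL_mem_tcl4All, companionSL_mem_companionClass_of_sq_le (by norm_num),
      companionSL_mem_parabolic_mul_elliptic (sq_two_mul_cos_lt hα), four_lt_sq_iff]
    grind

theorem tcl2pm_mul_tcl3 {α : ℝ} (hα : α ∈ Set.Ioo 0 Real.pi) :
    tcl2pm * tcl3 α = (⋃ γ ∈ Set.Ioo 0 α, tcl3 γ) ∪ tcl2pp ∪ tcl4All := by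
  have hs : Set.Ioo 0 α ⊆ Set.Ioo 0 Real.pi := Set.Ioo_subset_Ioo_right hα.2.le
  have h1 := neg_two_lt_two_mul_cos hα
  have h2 := two_mul_cos_lt_two hα
  rw [tcl2pp_eq, tcl2pm_eq, tcl3_eq hα]
  refine (isConjClosed_companionClass_mul _ _).ext_companionSL
    ((isConjClosed_iUnion_tcl3.union (isConjClosed_companionClass _)).union
      isConjClosed_tcl4All) ?_ fun u => ?_
  · rw [Set.mem_union, Set.mem_union, one_mem_companionClass_mul]
    simp only [one_notMem_iUnion_tcl3 hs, one_notMem_companionClass, one_notMem_tcl4All, or_false,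
      iff_false, not_or]
    constructor
    · intro; linarith
    · norm_num
  · rw [Set.mem_union, Set.mem_union, companionSL_mem_iUnion_tcl3 hs, exists_cos_mem_Ioo_zero hα,
      companionSL_mem_tcl4All, companionSL_mem_companionClass_of_sq_le (by norm_num),
      companionSL_mem_negParabolic_mul_elliptic (sq_two_mul_cos_lt hα), four_lt_sq_iff]
    grind

theorem one_mem_elliptic_mul_iff {α β : ℝ} (hα : α ∈ Set.Ioo 0 Real.pi)
    (hβ : β ∈ Set.Ioo 0 Real.pi) :
    1 ∈ companionClass (2 * Real.cos α) * companionClass (2 * Real.cos β) ↔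
      α + β = Real.pi := by
  rw [one_mem_companionClass_mul, or_iff_left fun h => (sq_two_mul_cos_lt hα).not_gt h.2,
    ← mul_neg, ← Real.cos_pi_sub, mul_right_inj' two_ne_zero]
  constructor
  · intro h
    have := Real.injOn_cos (by constructor <;> linarith [hβ.1, hβ.2])
      (Set.Ioo_subset_Icc_self hα) h
    linarith
  · intro h
    rw [show Real.pi - β = α by linarith]

theorem tcl3_mul_tcl3_of_add_lt {α β : ℝ} (hα : α ∈ Set.Ioo 0 Real.pi)
    (hβ : β ∈ Set.Ioo 0 Real.pi) (h : α + β < Real.pi) :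
    tcl3 α * tcl3 β = (⋃ γ ∈ Set.Ico (α + β) Real.pi, tcl3 γ) ∪ tcl2pm ∪ tcl4All := by
  have hγ : α + β ∈ Set.Ioo 0 Real.pi := ⟨add_pos hα.1 hβ.1, h⟩
  have hs : Set.Ico (α + β) Real.pi ⊆ Set.Ioo 0 Real.pi :=
    fun γ h => ⟨hγ.1.trans_le h.1, h.2⟩
  have h1 := neg_two_lt_two_mul_cos hγ
  have h2 := two_mul_cos_lt_two hγ
  rw [tcl2pm_eq, tcl3_eq hα, tcl3_eq hβ]
  refine (isConjClosed_companionClass_mul _ _).ext_companionSL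
    ((isConjClosed_iUnion_tcl3.union (isConjClosed_companionClass _)).union
      isConjClosed_tcl4All) ?_ fun u => ?_
  · rw [Set.mem_union, Set.mem_union, one_mem_elliptic_mul_iff hα hβ]
    simp only [one_notMem_iUnion_tcl3 hs, one_notMem_companionClass, one_notMem_tcl4All, or_false,
      iff_false]
    exact h.ne
  · rw [Set.mem_union, Set.mem_union, companionSL_mem_iUnion_tcl3 hs, exists_cos_mem_Ico_pi hγ,
      companionSL_mem_tcl4All, companionSL_mem_companionClass_of_sq_le (by norm_num),
      companionSL_mem_elliptic_mul_of_add_lt hα hβ h, four_lt_sq_iff]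
    grind

theorem tcl3_mul_tcl3_of_add_eq {α β : ℝ} (hα : α ∈ Set.Ioo 0 Real.pi)
    (hβ : β ∈ Set.Ioo 0 Real.pi) (h : α + β = Real.pi) :
    tcl3 α * tcl3 β = {1} ∪ tcl4All := by
  rw [tcl3_eq hα, tcl3_eq hβ]
  refine (isConjClosed_companionClass_mul _ _).ext_companionSL
    (isConjClosed_one.union isConjClosed_tcl4All) ?_ fun u => ?_
  · simp [one_mem_elliptic_mul_iff hα hβ, h]
  · have h1 : toPSL (companionSL u) ≠ 1 := fun h =>
      one_notMem_companionClass u (h ▸ companionSL_mem_companionClass u)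
    rw [Set.mem_union, Set.mem_singleton_iff, or_iff_right h1, companionSL_mem_tcl4All,
      companionSL_mem_elliptic_mul_of_add_eq hα hβ h]

theorem tcl3_mul_tcl3_of_lt_add {α β : ℝ} (hα : α ∈ Set.Ioo 0 Real.pi)
    (hβ : β ∈ Set.Ioo 0 Real.pi) (h : Real.pi < α + β) :
    tcl3 α * tcl3 β =
      (⋃ γ ∈ Set.Ioc 0 (α + β - Real.pi), tcl3 γ) ∪ tcl2pp ∪ tcl4All := by
  have hγ : α + β - Real.pi ∈ Set.Ioo 0 Real.pi := by
    constructor <;> linarith [hα.2, hβ.2]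
  have hs : Set.Ioc 0 (α + β - Real.pi) ⊆ Set.Ioo 0 Real.pi :=
    fun γ h => ⟨h.1, h.2.trans_lt hγ.2⟩
  have h1 := neg_two_lt_two_mul_cos hγ
  have h2 := two_mul_cos_lt_two hγ
  rw [tcl2pp_eq, tcl3_eq hα, tcl3_eq hβ]
  refine (isConjClosed_companionClass_mul _ _).ext_companionSL
    ((isConjClosed_iUnion_tcl3.union (isConjClosed_companionClass _)).union
      isConjClosed_tcl4All) ?_ fun u => ?_
  · rw [Set.mem_union, Set.mem_union, one_mem_elliptic_mul_iff hα hβ]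
    simp only [one_notMem_iUnion_tcl3 hs, one_notMem_companionClass, one_notMem_tcl4All, or_false,
      iff_false]
    exact h.ne'
  · rw [Set.mem_union, Set.mem_union, companionSL_mem_iUnion_tcl3 hs, exists_cos_mem_Ioc_zero hγ,
      companionSL_mem_tcl4All, companionSL_mem_companionClass_of_sq_le (by norm_num),
      companionSL_mem_elliptic_mul_of_lt_add hα hβ h, four_lt_sq_iff]
    grind

/-! ### Triple and quadruple products up to the identity -/

theorem companionClass_param_cases (t : ℝ) :
    4 < t ^ 2 ∨ t = 2 ∨ t = -2 ∨ ∃ α ∈ Set.Ioo 0 Real.pi, t = 2 * Real.cos α := by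
  rcases lt_trichotomy (t ^ 2) 4 with h | h | h
  · exact Or.inr (Or.inr (Or.inr (exists_angle h)))
  · rw [show (4 : ℝ) = 2 ^ 2 by norm_num, sq_eq_sq_iff_eq_or_eq_neg] at h
    tauto
  · exact Or.inl h

/-- Any value below `-2` would do: it lies below every bound `t` or `2 cos (α + β)` in the criteria
for non-hyperbolic factors. -/
theorem hyperbolic_mem_mul (s t : ℝ) :
    toPSL (companionSL (-3)) ∈ companionClass s * companionClass t := by
  have hpar : ∀ t : ℝ, t ^ 2 ≤ 4 →
      toPSL (companionSL (-3)) ∈ companionClass 2 * companionClass t :=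
    fun t ht => companionSL_mem_parabolic_mul_of_lt (by nlinarith)
  have hneg : ∀ t : ℝ, t ^ 2 ≤ 4 →
      toPSL (companionSL (-3)) ∈ companionClass (-2) * companionClass t := by
    intro t ht
    rw [← companionSL_neg_mem_mul_neg, neg_neg,
      companionSL_neg_mem_iff (isConjClosed_companionClass_mul _ _) (by norm_num)]
    exact hpar _ (by rwa [neg_sq])
  rcases companionClass_param_cases s with hs | hs
  · exact companionSL_mem_hyperbolic_mul hs _ _
  rcases companionClass_param_cases t with ht | ht
  · rw [companionClass_mul_comm]
    exact companionSL_mem_hyperbolic_mul ht _ _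
  have ht4 : t ^ 2 ≤ 4 := by
    rcases ht with rfl | rfl | ⟨β, hβ, rfl⟩
    · norm_num
    · norm_num
    · exact (sq_two_mul_cos_lt hβ).le
  rcases hs with rfl | rfl | ⟨α, hα, rfl⟩
  · exact hpar t ht4
  · exact hneg t ht4
  have hs4 := (sq_two_mul_cos_lt hα).le
  rcases ht with rfl | rfl | ⟨β, hβ, rfl⟩
  · rw [companionClass_mul_comm]; exact hpar _ hs4
  · rw [companionClass_mul_comm]; exact hneg _ hs4
  · refine companionSL_mem_elliptic_mul_of_le hα hβ ?_ fun y _ _ h => Or.inr ?_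
    · linarith [Real.neg_one_le_cos (α + β)]
    · rw [h]; norm_num

theorem companionSL_mem_mul_mul (s t w u : ℝ) :
    toPSL (companionSL u) ∈ companionClass s * companionClass t * companionClass w := by
  have h := (isConjClosed_companionClass_mul s t).conjugatesOf_subset (hyperbolic_mem_mul s t)
  exact Set.mul_subset_mul_right h (companionSL_mem_hyperbolic_mul (by norm_num) w u)

theorem isConjClosed_companionClass_mul_mul (s t w : ℝ) :
    IsConjClosed (companionClass s * companionClass t * companionClass w) :=
  (isConjClosed_companionClass_mul s t).mul (isConjClosed_companionClass w)

theorem compl_one_subset_mul_mul (s t w : ℝ) :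
    {1}ᶜ ⊆ companionClass s * companionClass t * companionClass w :=
  (isConjClosed_companionClass_mul_mul s t w).compl_one_subset (companionSL_mem_mul_mul s t w)

theorem companionClass_mul_mul_mul (s t w v : ℝ) :
    companionClass s * companionClass t * companionClass w * companionClass v = Set.univ := by
  have hc := (isConjClosed_companionClass_mul_mul s t w).mul (isConjClosed_companionClass v)
  refine eq_univ_of_compl_one_subset (hc.compl_one_subset fun u => ?_) ?_
  · have h := (isConjClosed_companionClass_mul_mul s t w).conjugatesOf_subset
      (companionSL_mem_mul_mul s t w 3)
    exact Set.mul_subset_mul_right h (companionSL_mem_hyperbolic_mul (by norm_num) v u)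
  -- The triple product contains every nontrivial class, in particular the inverse of the fourth.
  · rw [one_mem_mul_companionClass (isConjClosed_companionClass_mul_mul s t w)]
    exact companionSL_mem_mul_mul s t w _

theorem one_mem_mul_mul_iff {s t w : ℝ} :
    1 ∈ companionClass s * companionClass t * companionClass w ↔
      toPSL (companionSL (-w)) ∈ companionClass s * companionClass t :=
  one_mem_mul_companionClass (isConjClosed_companionClass_mul s t) w

/-! ### Exceptional triples -/

theorem ListedTriple.exists_eq {M : Multiset (Set PSL2R)} (hM : ListedTriple M) :
    ∃ s t w, M = {companionClass s, companionClass t, companionClass w} ∧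
      1 ∉ companionClass s * companionClass t * companionClass w := by
  simp only [one_mem_mul_mul_iff]
  -- Used to put the parabolic class last, so that the test concerns a product of two elliptic
  -- classes.
  have cyc : ∀ A B C : Set PSL2R, ({A, B, C} : Multiset (Set PSL2R)) = {B, C, A} := by
    intro A B C
    simp only [Multiset.insert_eq_cons]
    rw [Multiset.cons_swap A B, ← Multiset.cons_zero, ← Multiset.cons_zero,
      Multiset.cons_swap A C]
  induction hM with
  | pp_pm_rot α hα =>
    refine ⟨_, _, _, by rw [tcl2pp_eq, tcl2pm_eq, tcl3_eq hα], ?_⟩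
    rw [companionSL_mem_parabolic_mul_opposite, neg_sq]
    exact not_le.2 (sq_two_mul_cos_lt hα)
  | pm_rot_rot_lt α β hα hβ h =>
    refine ⟨_, _, _, by rw [cyc, tcl2pm_eq, tcl3_eq hα, tcl3_eq hβ], ?_⟩
    rw [companionSL_mem_elliptic_mul_of_add_lt hα hβ h]
    have := two_mul_cos_lt_two ⟨add_pos hα.1 hβ.1, h⟩
    norm_num
    linarith
  | pp_rot_rot_eq α β hα hβ h =>
    refine ⟨_, _, _, by rw [cyc, tcl2pp_eq, tcl3_eq hα, tcl3_eq hβ], ?_⟩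
    rw [companionSL_mem_elliptic_mul_of_add_eq hα hβ h]
    norm_num
  | pm_rot_rot_eq α β hα hβ h =>
    refine ⟨_, _, _, by rw [cyc, tcl2pm_eq, tcl3_eq hα, tcl3_eq hβ], ?_⟩
    rw [companionSL_mem_elliptic_mul_of_add_eq hα hβ h]
    norm_num
  | pp_rot_rot_gt α β hα hβ h =>
    refine ⟨_, _, _, by rw [cyc, tcl2pp_eq, tcl3_eq hα, tcl3_eq hβ], ?_⟩
    rw [companionSL_mem_elliptic_mul_of_lt_add hα hβ h]
    have := neg_two_lt_two_mul_cos
      (show α + β - Real.pi ∈ Set.Ioo 0 Real.pi by constructor <;> linarith [hα.2, hβ.2])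
    rintro (h' | h') <;> linarith
  | rot_rot_rot α β γ hα hβ hγ h₁ h₂ =>
    refine ⟨_, _, _, by rw [tcl3_eq hα, tcl3_eq hβ, tcl3_eq hγ], ?_⟩
    have hγ' : Real.pi - γ ∈ Set.Ioo 0 Real.pi := by constructor <;> linarith [hγ.1, hγ.2]
    have g1 := neg_two_lt_two_mul_cos hγ'
    have g2 := two_mul_cos_lt_two hγ'
    rw [← mul_neg, ← Real.cos_pi_sub]
    rcases lt_trichotomy (α + β) Real.pi with h | h | h
    · rw [companionSL_mem_elliptic_mul_of_add_lt hα hβ h, or_iff_left g2.not_gt,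
        two_mul_cos_le_iff (Set.Ioo_subset_Icc_self hγ') ⟨(add_pos hα.1 hβ.1).le, h.le⟩]
      linarith
    · rw [companionSL_mem_elliptic_mul_of_add_eq hα hβ h]
      exact (sq_two_mul_cos_lt hγ').not_gt
    · rw [companionSL_mem_elliptic_mul_of_lt_add hα hβ h, or_iff_left g1.not_gt,
        two_mul_cos_le_iff (by constructor <;> linarith [hα.2, hβ.2])
          (Set.Ioo_subset_Icc_self hγ')]
      linarith

/-- A set closed under conjugation commutes with every set, so only two of the three need this
property. -/
theorem mul_mul_eq_of_multiset_eq {G : Type*} [Group G] {X Y Z A B C : Set G}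
    (hA : IsConjClosed A) (hB : IsConjClosed B)
    (h : ({X, Y, Z} : Multiset (Set G)) = {A, B, C}) : X * Y * Z = A * B * C := by
  have hp : List.Perm [A, B, C] [X, Y, Z] := Multiset.coe_eq_coe.1 h.symm
  have := hp.prod_eq' (by
    simp only [List.pairwise_cons, List.mem_cons, List.not_mem_nil]
    refine ⟨fun D _ => hA.mul_comm, fun D _ => hB.mul_comm, by simp, by simp⟩)
  simpa [mul_assoc] using this.symm

theorem mul_mul_of_listedTriple {X Y Z : Set PSL2R} (h : ListedTriple {X, Y, Z}) :
    X * Y * Z = {1}ᶜ := by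
  obtain ⟨s, t, w, hM, h1⟩ := h.exists_eq
  rw [mul_mul_eq_of_multiset_eq (isConjClosed_companionClass s) (isConjClosed_companionClass t) hM]
  exact Set.Subset.antisymm (Set.subset_compl_singleton_iff.2 h1) (compl_one_subset_mul_mul s t w)

/-- The triple product contains the identity, or the triple is exceptional. -/
def ListedOrOneMem (s t w : ℝ) : Prop :=
  ListedTriple {companionClass s, companionClass t, companionClass w} ∨
    1 ∈ companionClass s * companionClass t * companionClass w

namespace ListedOrOneMem

variable {s t w : ℝ}

theorem swap_left (h : ListedOrOneMem s t w) : ListedOrOneMem t s w := by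
  rw [ListedOrOneMem, companionClass_mul_comm]
  simp only [Multiset.insert_eq_cons]
  rw [Multiset.cons_swap]
  exact h

theorem swap_right (h : ListedOrOneMem s t w) : ListedOrOneMem s w t := by
  rw [ListedOrOneMem, mul_assoc, companionClass_mul_comm w t, ← mul_assoc]
  simp only [Multiset.insert_eq_cons]
  rw [← Multiset.cons_zero, Multiset.cons_swap (companionClass w)]
  exact h

theorem rotate (h : ListedOrOneMem s t w) : ListedOrOneMem w s t := h.swap_right.swap_left

theorem of_hyperbolic (hs : 4 < s ^ 2) (t w : ℝ) : ListedOrOneMem s t w :=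
  Or.inr (one_mem_mul_mul_iff.2 (companionSL_mem_hyperbolic_mul hs t _))

theorem of_pp_pp (w : ℝ) : ListedOrOneMem 2 2 w :=
  Or.inr (one_mem_mul_mul_iff.2 (companionSL_mem_parabolic_mul_self _))

theorem of_pm_pm (w : ℝ) : ListedOrOneMem (-2) (-2) w :=
  Or.inr (one_mem_mul_mul_iff.2 (companionSL_mem_negParabolic_mul_self _))

variable {α β γ : ℝ}

theorem of_pp_pm_rot (hα : α ∈ Set.Ioo 0 Real.pi) :
    ListedOrOneMem 2 (-2) (2 * Real.cos α) := by
  left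
  rw [← tcl2pp_eq, ← tcl2pm_eq, ← tcl3_eq hα]
  exact .pp_pm_rot α hα

theorem of_pp_rot_rot (hα : α ∈ Set.Ioo 0 Real.pi) (hβ : β ∈ Set.Ioo 0 Real.pi) :
    ListedOrOneMem 2 (2 * Real.cos α) (2 * Real.cos β) := by
  rcases lt_trichotomy (α + β) Real.pi with h | h | h
  · refine rotate (Or.inr (one_mem_mul_mul_iff.2 ?_))
    rw [companionSL_mem_elliptic_mul_of_add_lt hα hβ h]
    left
    linarith [Real.neg_one_le_cos (α + β)]
  · left
    rw [← tcl2pp_eq, ← tcl3_eq hα, ← tcl3_eq hβ]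
    exact .pp_rot_rot_eq α β hα hβ h
  · left
    rw [← tcl2pp_eq, ← tcl3_eq hα, ← tcl3_eq hβ]
    exact .pp_rot_rot_gt α β hα hβ h

theorem of_pm_rot_rot (hα : α ∈ Set.Ioo 0 Real.pi) (hβ : β ∈ Set.Ioo 0 Real.pi) :
    ListedOrOneMem (-2) (2 * Real.cos α) (2 * Real.cos β) := by
  rcases lt_trichotomy (α + β) Real.pi with h | h | h
  · left
    rw [← tcl2pm_eq, ← tcl3_eq hα, ← tcl3_eq hβ]
    exact .pm_rot_rot_lt α β hα hβ h
  · left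
    rw [← tcl2pm_eq, ← tcl3_eq hα, ← tcl3_eq hβ]
    exact .pm_rot_rot_eq α β hα hβ h
  · refine rotate (Or.inr (one_mem_mul_mul_iff.2 ?_))
    rw [neg_neg, companionSL_mem_elliptic_mul_of_lt_add hα hβ h]
    left
    linarith [Real.cos_le_one (α + β - Real.pi)]

/-- Since `-2 cos γ = 2 cos (π - γ)`, the identity occurs if `α + β ≤ π - γ`, or if `π - γ ≤ α + β -
π`. The angle sums strictly between `π` and `2π` remain. -/
theorem of_rot_rot_rot (hα : α ∈ Set.Ioo 0 Real.pi) (hβ : β ∈ Set.Ioo 0 Real.pi)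
    (hγ : γ ∈ Set.Ioo 0 Real.pi) :
    ListedOrOneMem (2 * Real.cos α) (2 * Real.cos β) (2 * Real.cos γ) := by
  have hγ' : Real.pi - γ ∈ Set.Icc 0 Real.pi := by constructor <;> linarith [hγ.1, hγ.2]
  rcases le_or_gt (α + β + γ) Real.pi with h₁ | h₁
  · have h : α + β < Real.pi := by linarith [hγ.1]
    right
    rw [one_mem_mul_mul_iff, companionSL_mem_elliptic_mul_of_add_lt hα hβ h, ← mul_neg,
      ← Real.cos_pi_sub, two_mul_cos_le_iff hγ' ⟨(add_pos hα.1 hβ.1).le, h.le⟩]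
    left
    linarith
  rcases lt_or_ge (α + β + γ) (2 * Real.pi) with h₂ | h₂
  · left
    rw [← tcl3_eq hα, ← tcl3_eq hβ, ← tcl3_eq hγ]
    exact .rot_rot_rot α β γ hα hβ hγ h₁ h₂
  · have h : Real.pi < α + β := by linarith [hγ.2]
    right
    rw [one_mem_mul_mul_iff, companionSL_mem_elliptic_mul_of_lt_add hα hβ h, ← mul_neg,
      ← Real.cos_pi_sub,
      two_mul_cos_le_iff (by constructor <;> linarith [hα.2, hβ.2]) hγ']
    left
    linarith

end ListedOrOneMem

open ListedOrOneMem in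
-- A hyperbolic factor or a repeated parabolic class settles the matter at once. Up to order, the
-- other cases are two opposite parabolics with an elliptic, one parabolic with two elliptics, and
-- three elliptics.
theorem listedOrOneMem (s t w : ℝ) : ListedOrOneMem s t w := by
  rcases companionClass_param_cases s with hs | hs
  · exact of_hyperbolic hs t w
  rcases companionClass_param_cases t with ht | ht
  · exact (of_hyperbolic ht s w).swap_left
  rcases companionClass_param_cases w with hw | hw
  · exact (of_hyperbolic hw s t).rotate.rotate
  rcases hs with rfl | rfl | ⟨α, hα, rfl⟩ <;> rcases ht with rfl | rfl | ⟨β, hβ, rfl⟩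
  · exact of_pp_pp w
  · rcases hw with rfl | rfl | ⟨γ, hγ, rfl⟩
    · exact (of_pp_pp _).swap_right
    · exact (of_pm_pm _).rotate
    · exact of_pp_pm_rot hγ
  · rcases hw with rfl | rfl | ⟨γ, hγ, rfl⟩
    · exact (of_pp_pp _).swap_right
    · exact (of_pp_pm_rot hβ).swap_right
    · exact of_pp_rot_rot hβ hγ
  · rcases hw with rfl | rfl | ⟨γ, hγ, rfl⟩
    · exact (of_pp_pp _).rotate
    · exact (of_pm_pm _).swap_right
    · exact (of_pp_pm_rot hγ).swap_left
  · exact of_pm_pm w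
  · rcases hw with rfl | rfl | ⟨γ, hγ, rfl⟩
    · exact (of_pp_pm_rot hβ).rotate.rotate
    · exact (of_pm_pm _).swap_right
    · exact of_pm_rot_rot hβ hγ
  · rcases hw with rfl | rfl | ⟨γ, hγ, rfl⟩
    · exact (of_pp_pp _).rotate
    · exact (of_pp_pm_rot hα).rotate
    · exact (of_pp_rot_rot hα hγ).swap_left
  · rcases hw with rfl | rfl | ⟨γ, hγ, rfl⟩
    · exact (of_pp_pm_rot hα).swap_left.rotate
    · exact (of_pm_pm _).rotate
    · exact (of_pm_rot_rot hα hγ).swap_left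
  · rcases hw with rfl | rfl | ⟨γ, hγ, rfl⟩
    · exact (of_pp_rot_rot hα hβ).rotate.rotate
    · exact (of_pm_rot_rot hα hβ).rotate.rotate
    · exact of_rot_rot_rot hα hβ hγ

theorem mul_mul_eq_univ {X Y Z : Set PSL2R} (hX : IsNontrivialClass X) (hY : IsNontrivialClass Y)
    (hZ : IsNontrivialClass Z) (h : ¬ ListedTriple {X, Y, Z}) : X * Y * Z = Set.univ := by
  obtain ⟨s, rfl⟩ := isNontrivialClass_iff.1 hX
  obtain ⟨t, rfl⟩ := isNontrivialClass_iff.1 hY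
  obtain ⟨w, rfl⟩ := isNontrivialClass_iff.1 hZ
  exact eq_univ_of_compl_one_subset (compl_one_subset_mul_mul s t w)
    ((listedOrOneMem s t w).resolve_left h)

theorem mul_mul_mul_eq_univ {X Y Z W : Set PSL2R} (hX : IsNontrivialClass X)
    (hY : IsNontrivialClass Y) (hZ : IsNontrivialClass Z) (hW : IsNontrivialClass W) :
    X * Y * Z * W = Set.univ := by
  obtain ⟨s, rfl⟩ := isNontrivialClass_iff.1 hX
  obtain ⟨t, rfl⟩ := isNontrivialClass_iff.1 hY
  obtain ⟨w, rfl⟩ := isNontrivialClass_iff.1 hZ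
  obtain ⟨v, rfl⟩ := isNontrivialClass_iff.1 hW
  exact companionClass_mul_mul_mul s t w v

theorem corollary3p3 :
    -- (a) double products: the displayed formulas
    ((∀ l : ℝˣ, 1 < |(l : ℝ)| → tcl4 l * tcl4 l = Set.univ) ∧
      tcl2pp * tcl2pp = {1}ᶜ ∧
      tcl2pm * tcl2pm = {1}ᶜ ∧
      (∀ l : ℝˣ, 1 < |(l : ℝ)| → ∀ X : Set PSL2R, IsNontrivialClass X → X ≠ tcl4 l →
        tcl4 l * X = {1}ᶜ) ∧
      -- (a) the other double products
      tcl2pp * tcl2pm = {1} ∪ tcl2pp ∪ tcl2pm ∪ tcl4All ∧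
      (∀ α ∈ Set.Ioo 0 Real.pi,
        tcl2pp * tcl3 α = (⋃ γ ∈ Set.Ioo α Real.pi, tcl3 γ) ∪ tcl2pm ∪ tcl4All ∧
        tcl2pm * tcl3 α = (⋃ γ ∈ Set.Ioo 0 α, tcl3 γ) ∪ tcl2pp ∪ tcl4All) ∧
      (∀ α ∈ Set.Ioo 0 Real.pi, ∀ β ∈ Set.Ioo 0 Real.pi,
        (α + β < Real.pi →
          tcl3 α * tcl3 β = (⋃ γ ∈ Set.Ico (α + β) Real.pi, tcl3 γ) ∪ tcl2pm ∪ tcl4All) ∧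
        (α + β = Real.pi → tcl3 α * tcl3 β = {1} ∪ tcl4All) ∧
        (Real.pi < α + β →
          tcl3 α * tcl3 β =
            (⋃ γ ∈ Set.Ioc 0 (α + β - Real.pi), tcl3 γ) ∪ tcl2pp ∪ tcl4All))) ∧
    -- (b) triple products
    ((∀ X Y Z : Set PSL2R, ListedTriple {X, Y, Z} → X * Y * Z = {1}ᶜ) ∧
      (∀ X Y Z : Set PSL2R, IsNontrivialClass X → IsNontrivialClass Y → IsNontrivialClass Z →
        ¬ ListedTriple {X, Y, Z} → X * Y * Z = Set.univ)) ∧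
    -- (c) quadruple products
    (∀ X Y Z W : Set PSL2R, IsNontrivialClass X → IsNontrivialClass Y → IsNontrivialClass Z →
      IsNontrivialClass W → X * Y * Z * W = Set.univ) := by
  exact ⟨⟨fun _ hl => tcl4_mul_self hl, tcl2pp_mul_self, tcl2pm_mul_self,
    fun _ hl _ hX hne => tcl4_mul_of_ne hl hX hne, tcl2pp_mul_tcl2pm,
    fun _ hα => ⟨tcl2pp_mul_tcl3 hα, tcl2pm_mul_tcl3 hα⟩,
    fun _ hα _ hβ => ⟨tcl3_mul_tcl3_of_add_lt hα hβ, tcl3_mul_tcl3_of_add_eq hα hβ,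
      tcl3_mul_tcl3_of_lt_add hα hβ⟩⟩,
    ⟨fun _ _ _ h => mul_mul_of_listedTriple h,
      fun _ _ _ hX hY hZ h => mul_mul_eq_univ hX hY hZ h⟩,
    fun _ _ _ _ hX hY hZ hW => mul_mul_mul_eq_univ hX hY hZ hW⟩
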